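/- Let $k$ be a field and let $A$ be a finite-dimensional Hopf algebra over $k$ with invertible antipode $\gamma$; write $\bar\gamma=\gamma^{-1}$, $\Delta(a)=\sum a'\otimes a''$ and $(\Delta\otimes 1)\Delta(a)=\sum a'\otimes a''\otimes a'''$. Let $A^*$ be the dual Hopf algebra, with $(fg)(x)=\sum f(x')g(x'')$, $1_{A^*}=\varepsilon$ and coproduct $\Delta(f)=\sum f'\otimes f''$, where $\sum f'(x)f''(y)=f(xy)$. For $g\in A^*$ and $x,y\in A$, $g(x\,?\,y)$ denotes the functional $z\mapsto g(xzy)$, and $\bar\gamma^*(f)=f\circ\bar\gamma$. Let $(e_a)$ be a basis of $A$ with dual basis $(e^a)$. **Algebras.** The Drinfeld double $D(A)$ and the Heisenberg double $H(A)$ are the vector space $A^*\otimes A$ with unit $1\otimes 1$ and the products $$D(A):\ (f\otimes a)(g\otimes b)=\sum f\,g(\bar\gamma(a''')\,?\,a')\otimes a''b,\qquad H(A):\ (f\otimes a)(g\otimes b)=\sum f\,g(?\,a')\otimes a''b .$$ $D(A)$ has the universal $R$-matrix $R=\sum_a(1\otimes e_a)\otimes(e^a\otimes 1)$ and the antipode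 $\gamma(f\otimes a)=(1\otimes\gamma(a))(\bar\gamma^*(f)\otimes 1)$. Let $\phi\colon D(A)\to H(A)\otimes H(A)^{\mathrm{op}}$ be the linear map with $\phi(f\otimes x)=\phi(f\otimes 1)\,\phi(1\otimes x)$, $$\phi(f\otimes1)=\sum (f''\otimes 1)\otimes(\bar\gamma^*(f')\otimes 1),\qquad \phi(1\otimes x)=\sum(1\otimes x')\otimes(1\otimes\gamma(x'')).$$ Put $\tilde e_a=\gamma(e_a)$, $\tilde e^a=\bar\gamma^*(e^a)$ and $$S=\sum_a (1\otimes e_a)\otimes (e^a\otimes 1)\in H(A)\otimes H(A),\qquad S'=\sum_a (1\otimes\tilde e_a)\otimes (e^a\otimes 1)\in H(A)^{\mathrm{op}}\otimes H(A),$$ $$S''=\sum_a (1\otimes e_a)\otimes(\tilde e^a\otimes 1)\in H(A)\otimes H(A)^{\mathrm{op}},\qquad \tilde S=\sum_a(1\otimes\tilde e_a)\otimes(\tilde e^a\otimes 1)\in H(A)^{\mathrm{op}}\otimes H(A)^{\mathrm{op}} ;$$ these are invertible. **Braids.** A braid diagram with $n$ components consists of $n$ strands that run monotonically between the top and the bottom,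 with finitely many crossings at distinct heights; each strand has an arbitrary orientation (up or down) and the strands are numbered $1,\dots,n$ in an arbitrary order. A braid $T$ is a class of such diagrams under isotopy, i.e. under the second and third Reidemeister moves and exchange of the heights of crossings on disjoint pairs of neighbouring strands (blackboard framing, no maxima or minima). Call a crossing positive if the strand running from the top left to the bottom right passes under the other one, and negative otherwise (whatever the orientations are). In all labels below the first tensorand is put on the under strand and the second one on the over strand. **The invariant $J(T)\in D(A)^{\otimes n}$.** In a diagram of $T$, put the label $(\gamma'\otimes\gamma')(R)$ on each positive crossing and $(\gamma'\otimes\gamma')(R^{-1})$ on each negative crossing, where each $\gamma'$ is $\gamma$ if the strand is oriented upwards and the identity otherwise. The $i$-th tensorand is the product of the labels on the $i$-th strand, read against the orientation and written from left to right; the sum over all the indices in the labels is taken. **The element $J'(D)\in\bigotimes_{i=1}^n (H(A)\otimes H(A)^{\mathrm{op}})$ of a braid diagram $D$.** Let $\zeta(D)$ be the diagram obtained from $D$ by replacing each strand by two parallel copies, of which the one on the left, when one follows the orientation, is made thick and the other one is thin; each crossing becomes four crossings of the same sign. Thin strands carry labels in $H(A)$ and thick strands carry labels in $H(A)^{\mathrm{op}}$.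 On each positive (resp. negative) crossing of $\zeta(D)$ put the label $(\gamma'\otimes(\bar\gamma^*)')(X)$ (resp. $(\gamma'\otimes(\bar\gamma^*)')(X^{-1})$), where $X$ is $S$, $S'$, $S''$ or $\tilde S$ according to whether the (under, over) strands are (thin, thin), (thick, thin), (thin, thick) or (thick, thick). Here $\gamma'$ and $(\bar\gamma^*)'$ are the linear maps $f\otimes x\mapsto f\otimes\gamma(x)$ and $f\otimes x\mapsto\bar\gamma^*(f)\otimes x$ if the strand is oriented upwards, and the identity otherwise. The $(2i-1)$-st and the $2i$-th tensorands of $J'(D)$ are the products of the labels on the thin and on the thick copy of the $i$-th strand, read against the orientation and written from left to right, in $H(A)$ and in $H(A)^{\mathrm{op}}$ respectively. **Statement.** Let $T$ be a braid with $n$ components and let $D$ be any braid diagram of $T$. Then $J(T)$ can be calculated from $D$ (it does not depend on the diagram), and $$\phi^{\otimes n}(J(T))=J'(D)\quad\in\ \bigotimes_{i=1}^n \left(H(A)\otimes H(A)^{\mathrm{op}}\right).$$ -/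

import Mathlib

open scoped TensorProduct

namespace HopfDouble

noncomputable section

open Coalgebra HopfAlgebra WithConv

section Actions

variable (k A : Type*) [Field k] [Ring A] [HopfAlgebra k A]

/-- The dual algebra `A^*`: linear functionals with the convolution product
`(f g)(x) = ∑ f(x') g(x'')` and unit the counit of `A`. -/
abbrev DualAlgebra := WithConv (A →ₗ[k] k)

/-- The left action `a ▹ g = g(? a)` of `A` on `A^*`. -/
def hitRight : A →ₐ[k] Module.End k (DualAlgebra k A) :=
  AlgHom.ofLinearMap
    (LinearMap.mk₂ k (fun a g => toConv (g.ofConv ∘ₗ LinearMap.mulRight k a))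
      (fun a b g => by ext x; simp [mul_add])
      (fun c a g => by ext x; simp)
      (fun a g h => by ext x; simp)
      (fun c a g => by ext x; simp))
    (by ext g x; simp)
    (fun a b => by ext g x; simp [mul_assoc])

variable {k A} in
@[simp] theorem hitRight_apply (a x : A) (g : DualAlgebra k A) :
    (hitRight k A a g).ofConv x = g.ofConv (x * a) := rfl

/-- `E ↦ E ⊗ id`, as an algebra homomorphism. -/
def actLeft : Module.End k (DualAlgebra k A) →ₐ[k] Module.End k (DualAlgebra k A ⊗[k] A) :=
  Module.End.rTensorAlgHom k _ _

/-- `a ↦ (g ⊗ b ↦ g ⊗ a b)`, as an algebra homomorphism. -/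
def actRight : A →ₐ[k] Module.End k (DualAlgebra k A ⊗[k] A) :=
  (Module.End.lTensorAlgHom k _ _).comp (Algebra.lmul k A)

/-- `f ↦ (g ⊗ b ↦ f g ⊗ b)`, as an algebra homomorphism. -/
def leftMul : DualAlgebra k A →ₐ[k] Module.End k (DualAlgebra k A ⊗[k] A) :=
  (actLeft k A).comp (Algebra.lmul k (DualAlgebra k A))

variable {k A} in
@[simp] theorem actLeft_tmul (E : Module.End k (DualAlgebra k A)) (g : DualAlgebra k A) (b : A) :
    actLeft k A E (g ⊗ₜ b) = E g ⊗ₜ b := rfl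

variable {k A} in
@[simp] theorem actRight_tmul (a : A) (g : DualAlgebra k A) (b : A) :
    actRight k A a (g ⊗ₜ b) = g ⊗ₜ (a * b) := rfl

variable {k A} in
@[simp] theorem leftMul_tmul (f g : DualAlgebra k A) (b : A) :
    leftMul k A f (g ⊗ₜ b) = (f * g) ⊗ₜ b := rfl

theorem actLeft_commute_actRight (E : Module.End k (DualAlgebra k A)) (a : A) :
    Commute (actLeft k A E) (actRight k A a) := by
  ext g b : 3
  simp

/-- `a ↦ (g ⊗ b ↦ ∑ g(? a') ⊗ a'' b)`. -/
def heisAct : A →ₐ[k] Module.End k (DualAlgebra k A ⊗[k] A) :=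
  (Algebra.TensorProduct.lift ((actLeft k A).comp (hitRight k A)) (actRight k A)
    (fun _ _ => actLeft_commute_actRight k A _ _)).comp (Bialgebra.comulAlgHom k A)

/-- `(f ⊗ a) ↦ (g ⊗ b ↦ ∑ f g(? a') ⊗ a'' b)`. -/
def heisMul : DualAlgebra k A ⊗[k] A →ₗ[k] Module.End k (DualAlgebra k A ⊗[k] A) :=
  TensorProduct.lift
    ((LinearMap.mul k (Module.End k (DualAlgebra k A ⊗[k] A))).compl₁₂
      (leftMul k A).toLinearMap (heisAct k A).toLinearMap)

variable {k A}
theorem heisMul_tmul (f : DualAlgebra k A) (a : A) :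
    heisMul k A (f ⊗ₜ a) = leftMul k A f * heisAct k A a := rfl

theorem heisAct_tmul (a b : A) (g : DualAlgebra k A) {ι : Type*} (r : Coalgebra.Repr k a ι) :
    heisAct k A a (g ⊗ₜ b) = ∑ i ∈ r.index, hitRight k A (r.left i) g ⊗ₜ (r.right i * b) := by
  simp only [heisAct, AlgHom.comp_apply, Bialgebra.comulAlgHom_apply, ← r.eq, map_sum,
    LinearMap.sum_apply]
  rfl

theorem heisMul_tmul_tmul (f g : DualAlgebra k A) (a b : A) {ι : Type*} (r : Coalgebra.Repr k a ι) :
    heisMul k A (f ⊗ₜ a) (g ⊗ₜ b) =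
      ∑ i ∈ r.index, (f * hitRight k A (r.left i) g) ⊗ₜ (r.right i * b) := by
  simp [heisMul_tmul, heisAct_tmul a b g r]

theorem hitRight_mul (a : A) (g h : DualAlgebra k A) {ι : Type*} (r : Coalgebra.Repr k a ι) :
    hitRight k A a (g * h) =
      ∑ i ∈ r.index, hitRight k A (r.left i) g * hitRight k A (r.right i) h := by
  ext x
  change (g * h) (x * a) = _
  rw [((ℛ k x).mul r).convMul_apply, WithConv.ofConv_sum, LinearMap.sum_apply]
  refine (Finset.sum_product_right _ _ _).trans (Finset.sum_congr rfl fun i _ => ?_)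
  exact ((ℛ k x).convMul_apply (hitRight k A (r.left i) g) (hitRight k A (r.right i) h)).symm

theorem hitRight_one (a : A) : hitRight k A a 1 = counit (R := k) a • 1 := by
  ext x
  simp [mul_comm]

/-- The exchange relation. -/
theorem heisAct_leftMul (a : A) (g : DualAlgebra k A) {ι : Type*} (r : Coalgebra.Repr k a ι) :
    heisAct k A a * leftMul k A g =
      ∑ i ∈ r.index, leftMul k A (hitRight k A (r.left i) g) * heisAct k A (r.right i) := by
  ext h c : 3
  have key := congrArg ((TensorProduct.map (LinearMap.mul' k (DualAlgebra k A)) (LinearMap.mulRight k c)) ∘ₗ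
    (TensorProduct.assoc k _ _ _).symm.toLinearMap ∘ₗ
    TensorProduct.map ((hitRight k A).toLinearMap.flip g)
      (TensorProduct.map ((hitRight k A).toLinearMap.flip h) .id))
    (sum_tmul_tmul_eq r (fun i => ℛ k (r.left i)) (fun i => ℛ k (r.right i)))
  simp [map_sum] at key
  simp [heisAct_tmul _ _ _ r, heisAct_tmul _ _ _ (ℛ k (r.right _)), hitRight_mul _ _ _ (ℛ k (r.left _)), TensorProduct.sum_tmul]
  exact key


/-- A bilinear multiplication, given by its left multiplication operators, that is associative and
has the unit `e`, makes a vector space into a ring. -/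
abbrev ringOfLeftMul {V : Type*} [AddCommGroup V] [Module k V] (L : V →ₗ[k] Module.End k V) (e : V)
    (h₁ : L e = 1) (h₂ : ∀ x, L x e = x) (h₃ : ∀ x y, L (L x y) = L x * L y) : Ring V where
  __ := (inferInstance : AddCommGroup V)
  mul x y := L x y
  one := e
  left_distrib x y z := map_add (L x) y z
  right_distrib x y z := LinearMap.map_add₂ L x y z
  zero_mul x := LinearMap.map_zero₂ L x
  mul_zero x := map_zero (L x)
  mul_assoc x y z := LinearMap.congr_fun (h₃ x y) z
  one_mul x := LinearMap.congr_fun h₁ x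
  mul_one x := h₂ x

theorem heisMul_one : heisMul k A (1 ⊗ₜ 1) = 1 := by
  rw [heisMul_tmul, map_one, map_one, one_mul]

theorem heisAct_one_tmul (a b : A) : heisAct k A a (1 ⊗ₜ b) = 1 ⊗ₜ (a * b) := by
  rw [heisAct_tmul a b 1 (ℛ k a)]
  simp only [hitRight_one, TensorProduct.smul_tmul, ← TensorProduct.tmul_sum, ← smul_mul_assoc,
    ← Finset.sum_mul, sum_counit_smul]

theorem heisMul_apply_one (x : DualAlgebra k A ⊗[k] A) : heisMul k A x (1 ⊗ₜ 1) = x := by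
  induction x with
  | zero => simp
  | tmul f a => rw [heisMul_tmul, Module.End.mul_apply, heisAct_one_tmul]; simp
  | add x y hx hy => rw [map_add, LinearMap.add_apply, hx, hy]

theorem heisMul_heisMul (x y : DualAlgebra k A ⊗[k] A) :
    heisMul k A (heisMul k A x y) = heisMul k A x * heisMul k A y := by
  induction x with
  | zero => simp
  | add x y hx hy => rw [map_add, LinearMap.add_apply, map_add, hx, hy, add_mul]
  | tmul f a =>
    induction y with
    | zero => simp
    | add x y hx hy => rw [map_add, map_add, map_add, hx, hy, mul_add]
    | tmul g b =>
      rw [heisMul_tmul_tmul f g a b (ℛ k a), map_sum, heisMul_tmul, heisMul_tmul, mul_assoc,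
        ← mul_assoc (heisAct k A a), heisAct_leftMul a g (ℛ k a), Finset.sum_mul, Finset.mul_sum]
      simp only [heisMul_tmul, map_mul, mul_assoc]

end Actions

section Antipode

variable {k A : Type*} [Field k] [Ring A] [HopfAlgebra k A]

theorem comul_four :
    TensorProduct.map comul comul ∘ₗ (comul : A →ₗ[k] A ⊗[k] A) =
      (TensorProduct.assoc k A A (A ⊗[k] A)).symm.toLinearMap ∘ₗ
        TensorProduct.map .id (TensorProduct.assoc k A A A).toLinearMap ∘ₗ
        TensorProduct.map .id (TensorProduct.map comul .id) ∘ₗ TensorProduct.map .id comul ∘ₗ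
        comul := by
  simp only [coassoc_simps]

theorem comul_five :
    TensorProduct.map comul (TensorProduct.map .id comul) ∘ₗ TensorProduct.map .id comul ∘ₗ (comul : A →ₗ[k] A ⊗[k] A) =
      (TensorProduct.assoc k A A (A ⊗[k] (A ⊗[k] A))).symm.toLinearMap ∘ₗ
        TensorProduct.map .id (TensorProduct.map .id (TensorProduct.assoc k A A A).toLinearMap ∘ₗ (TensorProduct.assoc k A (A ⊗[k] A) A).toLinearMap) ∘ₗ
        TensorProduct.map .id (TensorProduct.map (TensorProduct.map .id comul ∘ₗ comul) .id) ∘ₗ TensorProduct.map .id comul ∘ₗ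
        comul := by
  simp only [coassoc_simps]

theorem comul_comp_antipode : (comul : A →ₗ[k] A ⊗[k] A) ∘ₗ antipode k =
    TensorProduct.map (antipode k) (antipode k) ∘ₗ
      (TensorProduct.comm k A A).toLinearMap ∘ₗ comul := by
  apply WithConv.toConv_injective
  symm
  refine left_inv_eq_right_inv (a := toConv (comul : A →ₗ[k] A ⊗[k] A)) ?_ LinearMap.comul_right_inv
  apply WithConv.ext
  have h1 : (LinearMap.mul' k (A ⊗[k] A) ∘ₗ TensorProduct.map (TensorProduct.map (antipode k) (antipode k) ∘ₗ
      (TensorProduct.comm k A A).toLinearMap) .id) ∘ₗ (TensorProduct.assoc k A A (A ⊗[k] A)).symm.toLinearMap ∘ₗ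
        TensorProduct.map .id (TensorProduct.assoc k A A A).toLinearMap =
      (TensorProduct.comm k A A).toLinearMap ∘ₗ 
      TensorProduct.map (LinearMap.mul' k A) .id ∘ₗ (TensorProduct.assoc k A A A).symm.toLinearMap ∘ₗ
      TensorProduct.map (antipode k) ((TensorProduct.comm k A A).toLinearMap ∘ₗ TensorProduct.map (LinearMap.mul' k A ∘ₗ TensorProduct.map (antipode k) .id) .id) := by
    ext a b c d
    simp
  have h2 : LinearMap.mul' k A ∘ₗ TensorProduct.map (antipode k) .id ∘ₗ comul = Algebra.linearMap k A ∘ₗ counit := mul_antipode_rTensor_comul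
  calc _ = (LinearMap.mul' k (A ⊗[k] A) ∘ₗ TensorProduct.map (TensorProduct.map (antipode k) (antipode k) ∘ₗ
      (TensorProduct.comm k A A).toLinearMap) .id) ∘ₗ (TensorProduct.map comul comul ∘ₗ (comul : A →ₗ[k] A ⊗[k] A)) := by
        simp only [LinearMap.convMul_def, ofConv_toConv, ← LinearMap.comp_assoc]
        congr 1
        simp only [LinearMap.comp_assoc, ← TensorProduct.map_comp, LinearMap.id_comp]
    _ = _ := by
        have h3 : (TensorProduct.comm k A A).toLinearMap ∘ₗ
            TensorProduct.map (LinearMap.mul' k A ∘ₗ TensorProduct.map (antipode k) .id) .id ∘ₗ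
            TensorProduct.map comul .id ∘ₗ comul = (TensorProduct.mk k A A).flip 1 := by
          ext x
          have h2' : ∀ y : A, LinearMap.mul' k A (TensorProduct.map (antipode k) .id (comul y)) =
              algebraMap k A (counit y) := fun y => LinearMap.congr_fun h2 y
          simp only [LinearMap.comp_apply, LinearEquiv.coe_coe]
          rw [← (ℛ k x).eq]
          simp only [map_sum, TensorProduct.map_tmul, LinearMap.comp_apply, LinearMap.id_apply, h2',
            TensorProduct.comm_tmul, Algebra.algebraMap_eq_smul_one, TensorProduct.tmul_smul,
            TensorProduct.smul_tmul', ← TensorProduct.sum_tmul, sum_counit_smul]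
          simp
        calc _ = (TensorProduct.comm k A A).toLinearMap ∘ₗ
              TensorProduct.map (LinearMap.mul' k A) .id ∘ₗ
              (TensorProduct.assoc k A A A).symm.toLinearMap ∘ₗ
              TensorProduct.map (antipode k) ((TensorProduct.mk k A A).flip 1) ∘ₗ comul := by
              rw [comul_four, ← h3]
              simp only [← LinearMap.comp_assoc] at h1 ⊢
              rw [h1]
              simp only [LinearMap.comp_assoc, ← TensorProduct.map_comp, LinearMap.comp_id,
                ]
          _ = _ := by
              ext a
              have h4 := LinearMap.congr_fun h2 a
              simp only [LinearMap.comp_apply] at h4 ⊢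
              rw [← (ℛ k a).eq] at h4 ⊢
              simp [map_sum, ← TensorProduct.tmul_sum] at h4 ⊢
              simp [h4, Algebra.algebraMap_eq_smul_one, TensorProduct.smul_tmul', TensorProduct.tmul_smul]

theorem sum_smul_counit {a : A} {ι : Type*} (r : Coalgebra.Repr k a ι) :
    ∑ i ∈ r.index, counit (R := k) (r.right i) • r.left i = a := by
  have h := congrArg (TensorProduct.rid k A) (sum_tmul_counit_eq r)
  simpa only [map_sum, TensorProduct.rid_tmul, one_smul] using h

end Antipode

/-- The antipode `γ` is invertible. -/
class InvertibleAntipode (k A : Type*) [Field k] [Ring A] [HopfAlgebra k A] : Prop where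
  bijective : Function.Bijective (antipode k : A →ₗ[k] A)

section Drinfeld

variable (k A : Type*) [Field k] [Ring A] [HopfAlgebra k A] [InvertibleAntipode k A]

/-- The inverse `γ⁻¹` of the antipode. -/
def antipodeInv : A →ₗ[k] A :=
  (LinearEquiv.ofBijective (antipode k : A →ₗ[k] A) InvertibleAntipode.bijective).symm

variable {A}

@[simp] theorem antipode_antipodeInv (a : A) : antipode k (antipodeInv k A a) = a :=
  (LinearEquiv.ofBijective (antipode k : A →ₗ[k] A) InvertibleAntipode.bijective).apply_symm_apply a

@[simp] theorem antipodeInv_antipode (a : A) : antipodeInv k A (antipode k a) = a :=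
  (LinearEquiv.ofBijective (antipode k : A →ₗ[k] A) InvertibleAntipode.bijective).symm_apply_apply a

theorem antipodeInv_mul (a b : A) :
    antipodeInv k A (a * b) = antipodeInv k A b * antipodeInv k A a := by
  apply (InvertibleAntipode.bijective (k := k) (A := A)).injective
  simp [antipode_mul_antidistrib]

@[simp] theorem antipodeInv_one : antipodeInv k A (1 : A) = 1 := by
  apply (InvertibleAntipode.bijective (k := k) (A := A)).injective
  simp

@[simp] theorem counit_antipodeInv (a : A) : counit (R := k) (antipodeInv k A a) = counit (R := k) a := by
  rw [← counit_antipode (R := k) (antipodeInv k A a), antipode_antipodeInv]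

theorem comul_antipodeInv (a : A) : (comul (antipodeInv k A a) : A ⊗[k] A) =
    TensorProduct.map (antipodeInv k A) (antipodeInv k A)
      (TensorProduct.comm k A A (comul a)) := by
  have h := LinearMap.congr_fun (comul_comp_antipode (k := k) (A := A)) (antipodeInv k A a)
  simp only [LinearMap.comp_apply, antipode_antipodeInv] at h
  rw [h]
  set t : A ⊗[k] A := comul (antipodeInv k A a)
  induction t with
  | zero => simp
  | tmul x y => simp
  | add x y hx hy =>
    simp only [map_add] at hx hy ⊢
    rw [← hx, ← hy]

variable (A)
/-- The left action `c ↦ (g ↦ g(γ⁻¹(c) ?))` of `A` on `A^*`. -/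
def hitLeft : A →ₐ[k] Module.End k (DualAlgebra k A) :=
  AlgHom.ofLinearMap
    (LinearMap.mk₂ k (fun c g => toConv (g.ofConv ∘ₗ LinearMap.mulLeft k (antipodeInv k A c)))
      (fun a b g => by ext x; simp [add_mul])
      (fun c a g => by ext x; simp)
      (fun a g h => by ext x; simp)
      (fun c a g => by ext x; simp))
    (by ext g x; simp)
    (fun a b => by ext g x; simp [antipodeInv_mul])

variable {A}
@[simp] theorem hitLeft_apply (c x : A) (g : DualAlgebra k A) :
    (hitLeft k A c g).ofConv x = g.ofConv (antipodeInv k A c * x) := rfl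

theorem hitLeft_mul (c : A) (g h : DualAlgebra k A) {ι : Type*} (r : Coalgebra.Repr k c ι) :
    hitLeft k A c (g * h) =
      ∑ i ∈ r.index, hitLeft k A (r.right i) g * hitLeft k A (r.left i) h := by
  ext x
  change (g * h) (antipodeInv k A c * x) = _
  let r' : Coalgebra.Repr k (antipodeInv k A c) ι :=
    { index := r.index
      left := fun i => antipodeInv k A (r.right i)
      right := fun i => antipodeInv k A (r.left i)
      eq := by rw [comul_antipodeInv, ← r.eq]; simp }
  rw [(r'.mul (ℛ k x)).convMul_apply, WithConv.ofConv_sum, LinearMap.sum_apply]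
  refine (Finset.sum_product _ _ _).trans (Finset.sum_congr rfl fun i _ => ?_)
  exact ((ℛ k x).convMul_apply (hitLeft k A (r.right i) g) (hitLeft k A (r.left i) h)).symm

theorem hitLeft_one (a : A) : hitLeft k A a 1 = counit (R := k) a • 1 := by
  ext x
  simp

theorem hitRight_commute_hitLeft (a c : A) : Commute (hitRight k A a) (hitLeft k A c) := by
  ext g x
  simp [mul_assoc]

variable (A)
/-- `a ↦ (g ⊗ b ↦ ∑ g(γ⁻¹(a''') ? a') ⊗ a'' b)`. -/
def drinAct : A →ₐ[k] Module.End k (DualAlgebra k A ⊗[k] A) :=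
  ((Algebra.TensorProduct.lift ((actLeft k A).comp (hitRight k A))
      (Algebra.TensorProduct.lift (actRight k A) ((actLeft k A).comp (hitLeft k A))
        (fun _ _ => (actLeft_commute_actRight k A _ _).symm))
      (fun a t => by
        induction t with
        | zero => simp
        | tmul b c =>
          change Commute (actLeft k A (hitRight k A a))
            (actRight k A b * actLeft k A (hitLeft k A c))
          exact (actLeft_commute_actRight k A _ _).mul_right
            ((hitRight_commute_hitLeft k a c).map (actLeft k A))
        | add s t hs ht => rw [map_add]; exact hs.add_right ht)).comp
    (Algebra.TensorProduct.map (AlgHom.id k A) (Bialgebra.comulAlgHom k A))).comp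
    (Bialgebra.comulAlgHom k A)

/-- `(f ⊗ a) ↦ (g ⊗ b ↦ ∑ f g(γ⁻¹(a''') ? a') ⊗ a'' b)`. -/
def drinMul : DualAlgebra k A ⊗[k] A →ₗ[k] Module.End k (DualAlgebra k A ⊗[k] A) :=
  TensorProduct.lift
    ((LinearMap.mul k (Module.End k (DualAlgebra k A ⊗[k] A))).compl₁₂
      (leftMul k A).toLinearMap (drinAct k A).toLinearMap)

variable {A}
theorem drinMul_tmul (f : DualAlgebra k A) (a : A) :
    drinMul k A (f ⊗ₜ a) = leftMul k A f * drinAct k A a := rfl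

theorem drinAct_tmul (a b : A) (g : DualAlgebra k A) {ι κ : Type*} (r : Coalgebra.Repr k a ι)
    (s : ∀ i, Coalgebra.Repr k (r.right i) κ) :
    drinAct k A a (g ⊗ₜ b) = ∑ i ∈ r.index, ∑ j ∈ (s i).index,
      hitRight k A (r.left i) (hitLeft k A ((s i).right j) g) ⊗ₜ ((s i).left j * b) := by
  simp only [drinAct, AlgHom.comp_apply, Bialgebra.comulAlgHom_apply, ← r.eq, map_sum,
    LinearMap.sum_apply, Algebra.TensorProduct.map_tmul, ← (s _).eq, TensorProduct.tmul_sum]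
  rfl

/-- The exchange relation. -/
theorem drinAct_leftMul (a : A) (g : DualAlgebra k A) {ι κ : Type*} (r : Coalgebra.Repr k a ι)
    (s : ∀ i, Coalgebra.Repr k (r.right i) κ) :
    drinAct k A a * leftMul k A g =
      ∑ i ∈ r.index, ∑ j ∈ (s i).index,
        leftMul k A (hitRight k A (r.left i) (hitLeft k A ((s i).right j) g)) *
          drinAct k A ((s i).left j) := by
  ext h c : 3
  let P (g : DualAlgebra k A) : A ⊗[k] A →ₗ[k] DualAlgebra k A := TensorProduct.lift
    ((hitRight k A).toLinearMap.compl₂ ((hitLeft k A).toLinearMap.flip g))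
  have hP (g : DualAlgebra k A) (x z : A) :
    P g (x ⊗ₜ z) = hitRight k A x (hitLeft k A z g) := rfl
  let Φ := TensorProduct.map (LinearMap.mul' k (DualAlgebra k A) ∘ₗ TensorProduct.map (P g) (P h) ∘ₗ
      (TensorProduct.tensorTensorTensorComm k A A A A).toLinearMap) (LinearMap.mulRight k c) ∘ₗ
    (TensorProduct.assoc k (A ⊗[k] A) (A ⊗[k] A) A).symm.toLinearMap ∘ₗ
    TensorProduct.map .id (TensorProduct.map (TensorProduct.comm k A A).toLinearMap .id ∘ₗ
      (TensorProduct.comm k A (A ⊗[k] A)).toLinearMap)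
  have hΦ (x₁ x₂ y z₁ z₂ : A) : Φ ((x₁ ⊗ₜ x₂) ⊗ₜ (y ⊗ₜ (z₁ ⊗ₜ z₂))) =
    (hitRight k A x₁ (hitLeft k A z₂ g) * hitRight k A x₂ (hitLeft k A z₁ h)) ⊗ₜ (y * c) := rfl
  have key := congrArg Φ (LinearMap.congr_fun (comul_five (k := k) (A := A)) a)
  have e1 : ∀ y : A, comul (R := k) y = ∑ i ∈ (ℛ k y).index, (ℛ k y).left i ⊗ₜ[k] (ℛ k y).right i :=
    fun y => (ℛ k y).eq.symm
  simp only [LinearMap.comp_apply, ← r.eq, ← (s _).eq, map_sum, TensorProduct.map_tmul, 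
    LinearMap.id_apply, TensorProduct.tmul_sum, TensorProduct.sum_tmul, e1 (r.left _),
    e1 ((s _).left _), e1 ((s _).right _), e1 ((ℛ k ((s _).left _)).right _), LinearEquiv.coe_coe,
    TensorProduct.assoc_tmul, TensorProduct.assoc_symm_tmul, hΦ] at key
  have hL (c : A) (g h : DualAlgebra k A) := hitLeft_mul k c g h (ℛ k c)
  have hR (c : A) (g h : DualAlgebra k A) := hitRight_mul c g h (ℛ k c)
  have hD (a b : A) (g : DualAlgebra k A) := drinAct_tmul k a b g (ℛ k a) (fun i => ℛ k _)
  simp only [TensorProduct.AlgebraTensorModule.curry_apply, LinearMap.restrictScalars_self,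
    TensorProduct.curry_apply, Module.End.mul_apply, leftMul_tmul, LinearMap.sum_apply,
    drinAct_tmul k a c (g * h) r s, hL, map_sum, hR, hD, TensorProduct.sum_tmul]
  exact key

theorem drinMul_one : drinMul k A (1 ⊗ₜ 1) = 1 := by
  rw [drinMul_tmul, map_one, map_one, one_mul]

theorem drinAct_one_tmul (a b : A) : drinAct k A a (1 ⊗ₜ b) = 1 ⊗ₜ (a * b) := by
  rw [drinAct_tmul k a b 1 (ℛ k a) (fun i => ℛ k _)]
  have h (i : A × A) (y : A) :
      ∑ j ∈ (ℛ k y).index, hitRight k A ((ℛ k a).left i)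
        (hitLeft k A ((ℛ k y).right j) 1) ⊗ₜ[k] ((ℛ k y).left j * b) =
      hitRight k A ((ℛ k a).left i) 1 ⊗ₜ[k] (y * b) := by
    simp only [hitLeft_one, map_smul, TensorProduct.smul_tmul, ← TensorProduct.tmul_sum,
      ← smul_mul_assoc, ← Finset.sum_mul, sum_smul_counit]
  simp only [h]
  simp only [hitRight_one, TensorProduct.smul_tmul, ← TensorProduct.tmul_sum, ← smul_mul_assoc,
    ← Finset.sum_mul, sum_counit_smul]

theorem drinMul_apply_one (x : DualAlgebra k A ⊗[k] A) : drinMul k A x (1 ⊗ₜ 1) = x := by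
  induction x with
  | zero => simp
  | tmul f a => rw [drinMul_tmul, Module.End.mul_apply, drinAct_one_tmul]; simp
  | add x y hx hy => rw [map_add, LinearMap.add_apply, hx, hy]

theorem drinMul_tmul_tmul (f g : DualAlgebra k A) (a b : A) {ι κ : Type*}
    (r : Coalgebra.Repr k a ι) (s : ∀ i, Coalgebra.Repr k (r.right i) κ) :
    drinMul k A (f ⊗ₜ a) (g ⊗ₜ b) = ∑ i ∈ r.index, ∑ j ∈ (s i).index,
      (f * hitRight k A (r.left i) (hitLeft k A ((s i).right j) g)) ⊗ₜ ((s i).left j * b) := by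
  simp [drinMul_tmul, drinAct_tmul k a b g r s]

theorem drinMul_drinMul (x y : DualAlgebra k A ⊗[k] A) :
    drinMul k A (drinMul k A x y) = drinMul k A x * drinMul k A y := by
  induction x with
  | zero => simp
  | add x y hx hy => rw [map_add, LinearMap.add_apply, map_add, hx, hy, add_mul]
  | tmul f a =>
    induction y with
    | zero => simp
    | add x y hx hy => rw [map_add, map_add, map_add, hx, hy, mul_add]
    | tmul g b =>
      rw [drinMul_tmul_tmul k f g a b (ℛ k a) (fun i => ℛ k _), drinMul_tmul, drinMul_tmul,
        mul_assoc, ← mul_assoc (drinAct k A a), drinAct_leftMul k a g (ℛ k a) (fun i => ℛ k _)]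
      simp only [map_sum, drinMul_tmul, map_mul, mul_assoc, Finset.sum_mul, Finset.mul_sum]

end Drinfeld


section Doubles

variable (k A : Type*) [Field k] [Ring A] [HopfAlgebra k A]

/-- The Heisenberg double `H(A)`: the vector space `A^* ⊗ A` with the multiplication
`(f ⊗ a)(g ⊗ b) = ∑ f g(? a') ⊗ a'' b` and the unit `1 ⊗ 1`. -/
def HeisenbergDouble := DualAlgebra k A ⊗[k] A

namespace HeisenbergDouble

instance instAddCommGroup : AddCommGroup (HeisenbergDouble k A) :=
  inferInstanceAs (AddCommGroup (DualAlgebra k A ⊗[k] A))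

instance instModule : Module k (HeisenbergDouble k A) :=
  inferInstanceAs (Module k (DualAlgebra k A ⊗[k] A))

instance instRing : Ring (HeisenbergDouble k A) :=
  ringOfLeftMul (V := HeisenbergDouble k A) (heisMul k A) ((1 : DualAlgebra k A) ⊗ₜ[k] (1 : A))
    heisMul_one heisMul_apply_one heisMul_heisMul

/-- The identification of the vector spaces `A^* ⊗ A` and `H(A)`. -/
def ofTensor : DualAlgebra k A ⊗[k] A ≃ₗ[k] HeisenbergDouble k A := LinearEquiv.refl k _

instance instAlgebra : Algebra k (HeisenbergDouble k A) :=
  Algebra.ofModule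
    (fun c x y => LinearMap.map_smul₂ (heisMul k A) c x y)
    (fun c x y => map_smul (heisMul k A x) c y)

variable {k A}

theorem one_def : (1 : HeisenbergDouble k A) = ofTensor k A (1 ⊗ₜ 1) := rfl

theorem mul_def (x y : DualAlgebra k A ⊗[k] A) :
    ofTensor k A x * ofTensor k A y = ofTensor k A (heisMul k A x y) := rfl

theorem ofTensor_mul_ofTensor (f g : DualAlgebra k A) (a b : A) {ι : Type*}
    (r : Coalgebra.Repr k a ι) :
    ofTensor k A (f ⊗ₜ a) * ofTensor k A (g ⊗ₜ b) =
      ∑ i ∈ r.index, ofTensor k A ((f * hitRight k A (r.left i) g) ⊗ₜ (r.right i * b)) := by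
  rw [mul_def, heisMul_tmul_tmul f g a b r, map_sum]

variable (k A)

/-- `a ↦ 1 ⊗ a`, the embedding of the algebra `A` into `H(A)`. -/
def ofAlg : A →ₐ[k] HeisenbergDouble k A :=
  AlgHom.ofLinearMap ((ofTensor k A).toLinearMap ∘ₗ TensorProduct.mk k _ A 1) rfl
    (fun a b => by
      change _ = ofTensor k A (heisMul k A (1 ⊗ₜ a) (1 ⊗ₜ b))
      rw [heisMul_tmul, map_one (leftMul k A), one_mul, heisAct_one_tmul]
      rfl)

/-- `f ↦ f ⊗ 1`, the embedding of the algebra `A^*` into `H(A)`. -/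
def ofDual : DualAlgebra k A →ₐ[k] HeisenbergDouble k A :=
  AlgHom.ofLinearMap ((ofTensor k A).toLinearMap ∘ₗ (TensorProduct.mk k _ A).flip 1) rfl
    (fun f g => by
      change _ = ofTensor k A (heisMul k A (f ⊗ₜ 1) (g ⊗ₜ 1))
      rw [heisMul_tmul, map_one (heisAct k A), mul_one, leftMul_tmul]
      rfl)

end HeisenbergDouble

/-- The Drinfeld double `D(A)`: the vector space `A^* ⊗ A` with the multiplication
`(f ⊗ a)(g ⊗ b) = ∑ f g(γ⁻¹(a''') ? a') ⊗ a'' b` and the unit `1 ⊗ 1`. -/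
def DrinfeldDouble := DualAlgebra k A ⊗[k] A

variable [InvertibleAntipode k A]

namespace DrinfeldDouble

instance instAddCommGroup : AddCommGroup (DrinfeldDouble k A) :=
  inferInstanceAs (AddCommGroup (DualAlgebra k A ⊗[k] A))

instance instModule : Module k (DrinfeldDouble k A) :=
  inferInstanceAs (Module k (DualAlgebra k A ⊗[k] A))

instance instRing : Ring (DrinfeldDouble k A) :=
  ringOfLeftMul (V := DrinfeldDouble k A) (drinMul k A) ((1 : DualAlgebra k A) ⊗ₜ[k] (1 : A))
    (drinMul_one k) (drinMul_apply_one k) (drinMul_drinMul k)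

/-- The identification of the vector spaces `A^* ⊗ A` and `D(A)`. -/
def ofTensor : DualAlgebra k A ⊗[k] A ≃ₗ[k] DrinfeldDouble k A := LinearEquiv.refl k _

instance instAlgebra : Algebra k (DrinfeldDouble k A) :=
  Algebra.ofModule
    (fun c x y => LinearMap.map_smul₂ (drinMul k A) c x y)
    (fun c x y => map_smul (drinMul k A x) c y)

variable {k A}

theorem one_def : (1 : DrinfeldDouble k A) = ofTensor k A (1 ⊗ₜ 1) := rfl

theorem mul_def (x y : DualAlgebra k A ⊗[k] A) :
    ofTensor k A x * ofTensor k A y = ofTensor k A (drinMul k A x y) := rfl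

theorem ofTensor_mul_ofTensor (f g : DualAlgebra k A) (a b : A) {ι κ : Type*}
    (r : Coalgebra.Repr k a ι) (s : ∀ i, Coalgebra.Repr k (r.right i) κ) :
    ofTensor k A (f ⊗ₜ a) * ofTensor k A (g ⊗ₜ b) =
      ∑ i ∈ r.index, ∑ j ∈ (s i).index, ofTensor k A
        ((f * hitRight k A (r.left i) (hitLeft k A ((s i).right j) g)) ⊗ₜ
          ((s i).left j * b)) := by
  rw [mul_def, drinMul_tmul_tmul k f g a b r s]
  simp only [map_sum]

variable (k A)

/-- `a ↦ 1 ⊗ a`, the embedding of the algebra `A` into `D(A)`. -/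
def ofAlg : A →ₐ[k] DrinfeldDouble k A :=
  AlgHom.ofLinearMap ((ofTensor k A).toLinearMap ∘ₗ TensorProduct.mk k _ A 1) rfl
    (fun a b => by
      change _ = ofTensor k A (drinMul k A (1 ⊗ₜ a) (1 ⊗ₜ b))
      rw [drinMul_tmul, map_one (leftMul k A), one_mul, drinAct_one_tmul]
      rfl)

/-- `f ↦ f ⊗ 1`, the embedding of the algebra `A^*` into `D(A)`. -/
def ofDual : DualAlgebra k A →ₐ[k] DrinfeldDouble k A :=
  AlgHom.ofLinearMap ((ofTensor k A).toLinearMap ∘ₗ (TensorProduct.mk k _ A).flip 1) rfl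
    (fun f g => by
      change _ = ofTensor k A (drinMul k A (f ⊗ₜ 1) (g ⊗ₜ 1))
      rw [drinMul_tmul, map_one (drinAct k A), mul_one, leftMul_tmul]
      rfl)

end DrinfeldDouble

/-- The map `γ⁻¹^* : A^* → A^*`, `f ↦ f ∘ γ⁻¹`. -/
def dualAntipodeInv : DualAlgebra k A →ₗ[k] DualAlgebra k A where
  toFun f := toConv (f.ofConv ∘ₗ antipodeInv k A)
  map_add' _ _ := rfl
  map_smul' _ _ := rfl

theorem dualAntipodeInv_apply (f : DualAlgebra k A) (x : A) :
    (dualAntipodeInv k A f).ofConv x = f.ofConv (antipodeInv k A x) := rfl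

theorem dualAntipodeInv_one : dualAntipodeInv k A 1 = 1 := by
  ext x
  simp [dualAntipodeInv_apply]

theorem dualAntipodeInv_mul (f g : DualAlgebra k A) :
    dualAntipodeInv k A (f * g) = dualAntipodeInv k A g * dualAntipodeInv k A f := by
  ext x
  change (f * g) (antipodeInv k A x) = (dualAntipodeInv k A g * dualAntipodeInv k A f) x
  rw [LinearMap.convMul_apply, LinearMap.convMul_apply, comul_antipodeInv, ← (ℛ k x).eq]
  simp [dualAntipodeInv_apply, mul_comm]

/-- The antipode of `D(A)`: the linear map with `γ(f ⊗ a) = γ(1 ⊗ a) γ(f ⊗ 1)`,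
`γ(1 ⊗ a) = 1 ⊗ γ(a)` and `γ(f ⊗ 1) = (γ⁻¹)^*(f) ⊗ 1`. -/
def DrinfeldDouble.antipode : DrinfeldDouble k A →ₗ[k] DrinfeldDouble k A :=
  TensorProduct.lift ((LinearMap.mul k (DrinfeldDouble k A)).flip.compl₁₂
      ((DrinfeldDouble.ofDual k A).toLinearMap ∘ₗ dualAntipodeInv k A)
      ((DrinfeldDouble.ofAlg k A).toLinearMap ∘ₗ HopfAlgebra.antipode k)) ∘ₗ
    (DrinfeldDouble.ofTensor k A).symm.toLinearMap

/-- `x ↦ γ(x)`, the embedding of the algebra `A` into `H(A)^op` twisted by the antipode. -/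
def twistedAlg : A →ₐ[k] (HeisenbergDouble k A)ᵐᵒᵖ :=
  AlgHom.ofLinearMap
    ((MulOpposite.opLinearEquiv k).toLinearMap ∘ₗ
      (HeisenbergDouble.ofAlg k A).toLinearMap ∘ₗ HopfAlgebra.antipode k)
    (by simp)
    (fun a b => by simp [antipode_mul_antidistrib])

/-- `f ↦ (γ⁻¹)^*(f)`, the embedding of the algebra `A^*` into `H(A)^op` twisted by `(γ⁻¹)^*`. -/
def twistedDual : DualAlgebra k A →ₐ[k] (HeisenbergDouble k A)ᵐᵒᵖ :=
  AlgHom.ofLinearMap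
    ((MulOpposite.opLinearEquiv k).toLinearMap ∘ₗ
      (HeisenbergDouble.ofDual k A).toLinearMap ∘ₗ dualAntipodeInv k A)
    (by simp [dualAntipodeInv_one])
    (fun f g => by simp [dualAntipodeInv_mul])

end Doubles

section Canonical

variable {k A X Y : Type*} [Field k] [Ring A] [HopfAlgebra k A] [FiniteDimensional k A]
  [Ring X] [Algebra k X] [Ring Y] [Algebra k Y]

/-- `∑_a P(e_a) ⊗ E(e^a)` for a basis `e_a` of `A` and its dual basis `e^a`. -/
def canonicalElement (P : A →ₗ[k] X) (E : DualAlgebra k A →ₗ[k] Y) : X ⊗[k] Y :=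
  ∑ i, P (Module.finBasis k A i) ⊗ₜ E (toConv ((Module.finBasis k A).coord i))

theorem canonicalElement_mul (P Q : A →ₗ[k] X) (E : DualAlgebra k A →ₐ[k] Y) :
    canonicalElement P E.toLinearMap * canonicalElement Q E.toLinearMap =
      canonicalElement (toConv P * toConv Q).ofConv E.toLinearMap := by
  set e := Module.finBasis k A with he
  have hE (f : DualAlgebra k A) : E f = ∑ l, f (e l) • E (toConv (e.coord l)) := by
    have : f = ∑ l, f (e l) • toConv (e.coord l) := by
      apply WithConv.ext
      rw [WithConv.ofConv_sum]
      refine e.ext fun j => ?_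
      simp
    conv_lhs => rw [this]
    simp only [map_sum, map_smul]
  have hc (x : A) : (toConv P * toConv Q) x =
      ∑ i, ∑ j, (toConv (e.coord i) * toConv (e.coord j)) x • (P (e i) * Q (e j)) := by
    rw [(ℛ k x).convMul_apply]
    simp only [(ℛ k x).convMul_apply, Finset.sum_smul]
    rw [Finset.sum_congr rfl fun i _ => Finset.sum_comm, Finset.sum_comm]
    refine Finset.sum_congr rfl fun t _ => ?_
    conv_lhs => rw [← e.sum_repr ((ℛ k x).left t), ← e.sum_repr ((ℛ k x).right t)]
    simp only [map_sum, map_smul, Finset.sum_mul_sum, smul_mul_smul_comm]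
    simp
  simp only [canonicalElement, ← he, Finset.sum_mul_sum, Algebra.TensorProduct.tmul_mul_tmul,
    AlgHom.toLinearMap_apply, ← map_mul]
  rw [Finset.sum_congr rfl fun i _ => Finset.sum_congr rfl fun j _ => by
    rw [hE (toConv (e.coord i) * toConv (e.coord j)), TensorProduct.tmul_sum]]
  rw [Finset.sum_congr rfl fun i _ => Finset.sum_comm, Finset.sum_comm]
  refine Finset.sum_congr rfl fun l _ => ?_
  change _ = (toConv P * toConv Q) (e l) ⊗ₜ _
  rw [hc]
  simp only [TensorProduct.sum_tmul, TensorProduct.smul_tmul]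

theorem canonicalElement_one (E : DualAlgebra k A →ₐ[k] Y) :
    canonicalElement (1 : WithConv (A →ₗ[k] X)).ofConv E.toLinearMap = 1 := by
  have h1 : (1 : DualAlgebra k A) =
      ∑ i, counit (R := k) (Module.finBasis k A i) • toConv ((Module.finBasis k A).coord i) := by
    apply WithConv.ext
    rw [WithConv.ofConv_sum]
    refine (Module.finBasis k A).ext fun j => ?_
    simp
  rw [Algebra.TensorProduct.one_def, ← map_one E, h1]
  simp only [canonicalElement, map_sum, map_smul, TensorProduct.tmul_sum]
  refine Finset.sum_congr rfl fun i _ => ?_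
  simp [Algebra.algebraMap_eq_smul_one, TensorProduct.smul_tmul]

/-- The element `∑_a P(e_a) ⊗ E(e^a)` for algebra homomorphisms `P` and `E`, together with its
inverse `∑_a P(γ(e_a)) ⊗ E(e^a)`. -/
def canonicalUnit (P : A →ₐ[k] X) (E : DualAlgebra k A →ₐ[k] Y) : (X ⊗[k] Y)ˣ where
  val := canonicalElement P.toLinearMap E.toLinearMap
  inv := canonicalElement (P.toLinearMap ∘ₗ antipode k) E.toLinearMap
  val_inv := by
    rw [canonicalElement_mul, ← canonicalElement_one E]
    congr 2
    ext x
    rw [(ℛ k x).convMul_apply]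
    simp [← map_mul, ← map_sum, sum_mul_antipode_eq_algebraMap_counit]
  inv_val := by
    rw [canonicalElement_mul, ← canonicalElement_one E]
    congr 2
    ext x
    rw [(ℛ k x).convMul_apply]
    simp [← map_mul, ← map_sum, sum_antipode_mul_eq_algebraMap_counit]

end Canonical

section Constructions

variable (k A : Type*) [Field k] [Ring A] [HopfAlgebra k A] [FiniteDimensional k A]

/-- The coproduct of `A^*`, dual to the product of `A`: `Δ(f) = ∑ f' ⊗ f''` with
`∑ f'(x) f''(y) = f(x y)`. In a basis `e_a` with dual basis `e^a` it is
`Δ(f) = ∑_a f(? e_a) ⊗ e^a`. -/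
def comulDual : DualAlgebra k A →ₗ[k] DualAlgebra k A ⊗[k] DualAlgebra k A :=
  ∑ i, (TensorProduct.mk k (DualAlgebra k A) (DualAlgebra k A)).flip
      (toConv ((Module.finBasis k A).coord i)) ∘ₗ hitRight k A (Module.finBasis k A i)

theorem comulDual_apply_apply (f : DualAlgebra k A) (x y : A) :
    TensorProduct.lift ((LinearMap.mul k k).compl₁₂
        (LinearMap.applyₗ x ∘ₗ (WithConv.linearEquiv k (A →ₗ[k] k)).toLinearMap)
        (LinearMap.applyₗ y ∘ₗ (WithConv.linearEquiv k (A →ₗ[k] k)).toLinearMap))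
      (comulDual k A f) = f (x * y) := by
  have h := congrArg (fun z => f.ofConv (x * z)) ((Module.finBasis k A).sum_repr y)
  simp only [Finset.mul_sum, map_sum, mul_smul_comm, map_smul, smul_eq_mul] at h
  simpa [comulDual, mul_comm] using h

variable [InvertibleAntipode k A]

/-- The universal `R`-matrix `R = ∑_a (1 ⊗ e_a) ⊗ (e^a ⊗ 1)` of `D(A)`. -/
def DrinfeldDouble.universalR : (DrinfeldDouble k A ⊗[k] DrinfeldDouble k A)ˣ :=
  canonicalUnit (DrinfeldDouble.ofAlg k A) (DrinfeldDouble.ofDual k A)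

/-- The map `φ : D(A) → H(A) ⊗ H(A)^op` with `φ(f ⊗ x) = φ(f ⊗ 1) φ(1 ⊗ x)`,
`φ(f ⊗ 1) = ∑ (f'' ⊗ 1) ⊗ ((γ⁻¹)^*(f') ⊗ 1)` and `φ(1 ⊗ x) = ∑ (1 ⊗ x') ⊗ (1 ⊗ γ(x''))`. -/
def phi : DrinfeldDouble k A →ₗ[k] HeisenbergDouble k A ⊗[k] (HeisenbergDouble k A)ᵐᵒᵖ :=
  TensorProduct.lift
      ((LinearMap.mul k (HeisenbergDouble k A ⊗[k] (HeisenbergDouble k A)ᵐᵒᵖ)).compl₁₂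
        (TensorProduct.map (HeisenbergDouble.ofDual k A).toLinearMap
            (twistedDual k A).toLinearMap ∘ₗ
          (TensorProduct.comm k (DualAlgebra k A) (DualAlgebra k A)).toLinearMap ∘ₗ
          comulDual k A)
        (TensorProduct.map (HeisenbergDouble.ofAlg k A).toLinearMap
            (twistedAlg k A).toLinearMap ∘ₗ
          comul)) ∘ₗ
    (DrinfeldDouble.ofTensor k A).symm.toLinearMap

namespace HeisenbergDouble

/-- `S = ∑_a (1 ⊗ e_a) ⊗ (e^a ⊗ 1)`. -/
def S : (HeisenbergDouble k A ⊗[k] HeisenbergDouble k A)ˣ :=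
  canonicalUnit (ofAlg k A) (ofDual k A)

/-- `S' = ∑_a (1 ⊗ γ(e_a)) ⊗ (e^a ⊗ 1)`. -/
def S' : ((HeisenbergDouble k A)ᵐᵒᵖ ⊗[k] HeisenbergDouble k A)ˣ :=
  canonicalUnit (twistedAlg k A) (ofDual k A)

/-- `S'' = ∑_a (1 ⊗ e_a) ⊗ ((γ⁻¹)^*(e^a) ⊗ 1)`. -/
def S'' : (HeisenbergDouble k A ⊗[k] (HeisenbergDouble k A)ᵐᵒᵖ)ˣ :=
  canonicalUnit (ofAlg k A) (twistedDual k A)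

/-- `∑_a (1 ⊗ γ(e_a)) ⊗ ((γ⁻¹)^*(e^a) ⊗ 1)`. -/
def STilde : ((HeisenbergDouble k A)ᵐᵒᵖ ⊗[k] (HeisenbergDouble k A)ᵐᵒᵖ)ˣ :=
  canonicalUnit (twistedAlg k A) (twistedDual k A)

/-- The linear map `f ⊗ x ↦ f ⊗ γ(x)` of `H(A)`. -/
def mapAntipode : HeisenbergDouble k A →ₗ[k] HeisenbergDouble k A :=
  (ofTensor k A).toLinearMap ∘ₗ TensorProduct.map .id (HopfAlgebra.antipode k) ∘ₗ
    (ofTensor k A).symm.toLinearMap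

/-- The linear map `f ⊗ x ↦ (γ⁻¹)^*(f) ⊗ x` of `H(A)`. -/
def mapDualAntipodeInv : HeisenbergDouble k A →ₗ[k] HeisenbergDouble k A :=
  (ofTensor k A).toLinearMap ∘ₗ TensorProduct.map (dualAntipodeInv k A) .id ∘ₗ
    (ofTensor k A).symm.toLinearMap

end HeisenbergDouble

end Constructions

section Braids

/-- The orientation of a strand of a braid diagram. -/
inductive Dir
  | down
  | up

/-- A crossing of the strands at the neighbouring positions `pos` and `pos + 1`, counted from the
left, of `N` vertical strands. At a positive crossing the strand that runs from the top left to the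
bottom right passes under the other strand, and at a negative crossing it passes over it.
(This sign does not depend on the orientations of the strands.) -/
@[ext]
structure Crossing (N : ℕ) where
  pos : ℕ
  lt : pos + 1 < N
  positive : Bool

namespace Crossing

variable {N : ℕ} (c : Crossing N)

/-- The position of the left strand. -/
def left : Fin N := ⟨c.pos, Nat.lt_of_succ_lt c.lt⟩

/-- The position of the right strand. -/
def right : Fin N := ⟨c.pos + 1, c.lt⟩

/-- The crossing with the over strand and the under strand interchanged. -/
def flip : Crossing N := { c with positive := !c.positive }

end Crossing

/-- A diagram of a braid with `n` components, i.e. an oriented tangle diagram with `n` ordered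
strands, each running monotonically between the top and the bottom, such that the crossings have
distinct heights; the framing is the blackboard framing. -/
structure BraidDiagram (n : ℕ) where
  /-- The crossings from top to bottom. -/
  crossings : List (Crossing n)
  /-- The component that starts at the given position, counted from the left, at the top. -/
  top : Equiv.Perm (Fin n)
  /-- The orientation of the given component. -/
  dir : Fin n → Dir

/-- The elementary isotopies of braid diagrams. -/
inductive BraidDiagram.Move {n : ℕ} : BraidDiagram n → BraidDiagram n → Prop
  /-- The second Reidemeister move. -/
  | cancel (u v : List (Crossing n)) (c : Crossing n) (top : Equiv.Perm (Fin n))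
      (dir : Fin n → Dir) :
      Move ⟨u ++ c :: c.flip :: v, top, dir⟩ ⟨u ++ v, top, dir⟩
  /-- The third Reidemeister move. -/
  | yangBaxter (u v : List (Crossing n)) (i : ℕ) (h₁ : i + 1 < n) (h₂ : i + 1 + 1 < n)
      (top : Equiv.Perm (Fin n)) (dir : Fin n → Dir) :
      Move ⟨u ++ ⟨i, h₁, true⟩ :: ⟨i + 1, h₂, true⟩ :: ⟨i, h₁, true⟩ :: v, top, dir⟩
        ⟨u ++ ⟨i + 1, h₂, true⟩ :: ⟨i, h₁, true⟩ :: ⟨i + 1, h₂, true⟩ :: v, top, dir⟩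
  /-- Two crossings on disjoint pairs of strands exchange their heights. -/
  | far (u v : List (Crossing n)) (c d : Crossing n) (h : c.pos + 1 < d.pos)
      (top : Equiv.Perm (Fin n)) (dir : Fin n → Dir) :
      Move ⟨u ++ c :: d :: v, top, dir⟩ ⟨u ++ d :: c :: v, top, dir⟩

/-- Braids with `n` oriented and ordered components: isotopy classes of braid diagrams. -/
def Braid (n : ℕ) := Quot (BraidDiagram.Move (n := n))

/-- `D` is a diagram of the braid `T`. -/
def BraidDiagram.IsDiagramOf {n : ℕ} (D : BraidDiagram n) (T : Braid n) : Prop :=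
  Quot.mk _ D = T

/-- A chosen diagram of a braid. -/
def Braid.diagram {n : ℕ} (T : Braid n) : BraidDiagram n := Quot.out T

theorem Braid.diagram_isDiagramOf {n : ℕ} (T : Braid n) : T.diagram.IsDiagramOf T :=
  Quot.out_eq T

variable {k : Type*} [Field k]

/-- Follow the strands through a list of crossings from top to bottom, and multiply the labels of
the crossings to `w`. Here `s p` is the strand at position `p`, and `act b x y` multiplies the
label of a positive (`b = true`) or negative (`b = false`) crossing whose first tensorand is on the
strand `x` and whose second tensorand is on the strand `y`. The first tensorand of the label of a
crossing is on the under strand. -/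
def readCrossings {N : ℕ} {σ W : Type*} (act : Bool → σ → σ → W → W) :
    List (Crossing N) → (Fin N → σ) → W → W
  | [], _, w => w
  | c :: cs, s, w =>
    readCrossings act cs (s ∘ Equiv.swap c.left c.right)
      (match c.positive with
        | true => act true (s c.left) (s c.right) w
        | false => act false (s c.right) (s c.left) w)

/-- The labels of a strand are read against the orientation and written from left to right. As
crossings are visited from top to bottom, a new label `x` is written on the left if the strand is
oriented downwards, and on the right if it is oriented upwards. -/
def writeLabel {W : Type*} [Semiring W] [Algebra k W] : Dir → W →ₗ[k] Module.End k W
  | .down => LinearMap.mul k W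
  | .up => (LinearMap.mul k W).flip

/-- A label on a strand is changed by the linear map `γ` if the strand is oriented upwards. -/
def twistLabel {X : Type*} [AddCommMonoid X] [Module k X] (γ : X →ₗ[k] X) : Dir → X →ₗ[k] X
  | .down => .id
  | .up => γ

/-- Write the label `(γ₁' ⊗ γ₂')(t)` of a crossing, where `t ∈ X ⊗ Y`, on two strands with the
orientations `d₁` and `d₂` whose labels are put into `W` by `ι₁` and `ι₂`. -/
def writeCrossing {W X Y : Type*} [Semiring W] [Algebra k W] [Semiring X] [Algebra k X]
    [Semiring Y] [Algebra k Y] (ι₁ : X →ₐ[k] W) (ι₂ : Y →ₐ[k] W) (γ₁ : X →ₗ[k] X) (γ₂ : Y →ₗ[k] Y)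
    (d₁ d₂ : Dir) (t : X ⊗[k] Y) : W →ₗ[k] W :=
  TensorProduct.lift ((LinearMap.mul k (Module.End k W)).compl₁₂
    (writeLabel d₁ ∘ₗ ι₁.toLinearMap) (writeLabel d₂ ∘ₗ ι₂.toLinearMap))
    (TensorProduct.map (twistLabel γ₁ d₁) (twistLabel γ₂ d₂) t)

/-- `X` if `b` is true, `X⁻¹` otherwise. -/
def signed {G : Type*} [Monoid G] (x : Gˣ) : Bool → G
  | true => x
  | false => ↑x⁻¹

variable (k) (A : Type*) [Ring A] [HopfAlgebra k A] [FiniteDimensional k A]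
  [InvertibleAntipode k A] {n : ℕ}

/-- Labels of the `i`-th strand are put into the `i`-th copy of `D(A)`. -/
def strandEmb (i : Fin n) : DrinfeldDouble k A →ₐ[k] ⨂[k] _ : Fin n, DrinfeldDouble k A :=
  PiTensorProduct.singleAlgHom (R := k) (A := fun _ : Fin n => DrinfeldDouble k A) i

/-- The universal invariant `J ∈ D(A)^{⊗ n}` calculated from a braid diagram: the label of a
positive crossing is `(γ' ⊗ γ')(R)`, and that of a negative crossing is `(γ' ⊗ γ')(R⁻¹)`. -/
def BraidDiagram.J (D : BraidDiagram n) : ⨂[k] _ : Fin n, DrinfeldDouble k A :=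
  readCrossings
    (fun b i j w => writeCrossing (strandEmb k A i) (strandEmb k A j)
      (DrinfeldDouble.antipode k A) (DrinfeldDouble.antipode k A) (D.dir i) (D.dir j)
      (signed (DrinfeldDouble.universalR k A) b) w)
    D.crossings D.top 1

/-- The universal quantum invariant `J(T) ∈ D(A)^{⊗ n}` of a braid `T`, calculated from a chosen
diagram. -/
def Braid.J (T : Braid n) : ⨂[k] _ : Fin n, DrinfeldDouble k A :=
  T.diagram.J k A

/-- The two copies of a strand in the duplicated diagram. -/
inductive Thickness
  | thin
  | thick

variable {k A}

/-- A crossing with both strands duplicated. -/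
def Crossing.duplicate (c : Crossing n) : List (Crossing (2 * n)) :=
  [⟨2 * c.pos + 1, by have := c.lt; omega, c.positive⟩,
    ⟨2 * c.pos, by have := c.lt; omega, c.positive⟩,
    ⟨2 * c.pos + 2, by have := c.lt; omega, c.positive⟩,
    ⟨2 * c.pos + 1, by have := c.lt; omega, c.positive⟩]

/-- The duplicated strands at the top, in their order from left to right. The copy that is on the
left when one follows the orientation is thick. -/
def BraidDiagram.duplicateTop (D : BraidDiagram n) (p : Fin (2 * n)) : Fin n × Thickness :=
  let i := D.top ⟨p / 2, by have := p.2; omega⟩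
  (i, match D.dir i, (decide ((p : ℕ) % 2 = 0) : Bool) with
    | .down, true => .thin
    | .down, false => .thick
    | .up, true => .thick
    | .up, false => .thin)

variable (k A)

/-- The thin copy of the `i`-th strand carries labels in the tensorand `H(A)` of the `i`-th copy of
`H(A) ⊗ H(A)^op`. -/
def thinEmb (i : Fin n) : HeisenbergDouble k A →ₐ[k]
    ⨂[k] _ : Fin n, HeisenbergDouble k A ⊗[k] (HeisenbergDouble k A)ᵐᵒᵖ :=
  (PiTensorProduct.singleAlgHom i).comp Algebra.TensorProduct.includeLeft

/-- The thick copy of the `i`-th strand carries labels in the tensorand `H(A)^op` of the `i`-th copy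
of `H(A) ⊗ H(A)^op`. -/
def thickEmb (i : Fin n) : (HeisenbergDouble k A)ᵐᵒᵖ →ₐ[k]
    ⨂[k] _ : Fin n, HeisenbergDouble k A ⊗[k] (HeisenbergDouble k A)ᵐᵒᵖ :=
  (PiTensorProduct.singleAlgHom i).comp Algebra.TensorProduct.includeRight

/-- Write the label of a crossing of the duplicated diagram: `S`, `S'`, `S''` or `S̃` or its inverse,
according to the thickness of the two strands, with `γ` (resp. `(γ⁻¹)^*`) applied to the first
(resp. second) tensorand if it is on a strand that is oriented upwards. -/
def writeDuplicated (d : Fin n → Dir) (b : Bool) :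
    Fin n × Thickness → Fin n × Thickness →
      ((⨂[k] _ : Fin n, HeisenbergDouble k A ⊗[k] (HeisenbergDouble k A)ᵐᵒᵖ) →ₗ[k]
        ⨂[k] _ : Fin n, HeisenbergDouble k A ⊗[k] (HeisenbergDouble k A)ᵐᵒᵖ)
  | (i, .thin), (j, .thin) =>
    writeCrossing (thinEmb k A i) (thinEmb k A j) (HeisenbergDouble.mapAntipode k A)
      (HeisenbergDouble.mapDualAntipodeInv k A) (d i) (d j) (signed (HeisenbergDouble.S k A) b)
  | (i, .thick), (j, .thin) =>
    writeCrossing (thickEmb k A i) (thinEmb k A j)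
      ((MulOpposite.opLinearEquiv k).conj (HeisenbergDouble.mapAntipode k A))
      (HeisenbergDouble.mapDualAntipodeInv k A) (d i) (d j) (signed (HeisenbergDouble.S' k A) b)
  | (i, .thin), (j, .thick) =>
    writeCrossing (thinEmb k A i) (thickEmb k A j) (HeisenbergDouble.mapAntipode k A)
      ((MulOpposite.opLinearEquiv k).conj (HeisenbergDouble.mapDualAntipodeInv k A)) (d i) (d j)
      (signed (HeisenbergDouble.S'' k A) b)
  | (i, .thick), (j, .thick) =>
    writeCrossing (thickEmb k A i) (thickEmb k A j)
      ((MulOpposite.opLinearEquiv k).conj (HeisenbergDouble.mapAntipode k A))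
      ((MulOpposite.opLinearEquiv k).conj (HeisenbergDouble.mapDualAntipodeInv k A)) (d i) (d j)
      (signed (HeisenbergDouble.STilde k A) b)

/-- The element `J'(D)` of `(H(A) ⊗ H(A)^op)^{⊗ n}`. -/
def BraidDiagram.J' (D : BraidDiagram n) :
    ⨂[k] _ : Fin n, HeisenbergDouble k A ⊗[k] (HeisenbergDouble k A)ᵐᵒᵖ :=
  readCrossings (fun b x y w => writeDuplicated k A D.dir b x y w)
    (D.crossings.flatMap Crossing.duplicate) D.duplicateTop 1

end Braids

end

end HopfDouble

/-! Let labels act on the algebra that receives them, by left multiplication on a downward strand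
and by right multiplication on an upward one. Right multiplication reverses products, and so do `γ`
and `(γ⁻¹)^*`; the reversals cancel. So, whatever its orientation, a strand `i` carries an algebra
homomorphism `α_i` from `A` and one `β_i` from `A^*` into operators. A positive crossing with under
strand `i` and over strand `j` is the operator `∑ α_i(e_a) β_j(e^a)`, and a negative one is its
inverse (`crossOp_mul_crossOp_not`). Orientations play no further role in the crossing calculus.

Independence of the diagram. Operators on disjoint strands commute, and opposite crossings cancel.
For the third Reidemeister move, `pairing_mul_pairing` is `(Δ ⊗ 1)(R) = R₁₃R₂₃`, and the relation
`Exchange` between `α` and `β` gives `RΔ = Δ^op R`; together they give `pairing_yangBaxter`.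
`Exchange` holds in `D(A)` (`DrinfeldDouble.exchange`) and passes to strands of either orientation
(`exchange_strand`).

Comparison with `J'`. A pair of homomorphisms from `A` and `A^*` satisfying `Exchange` defines a
homomorphism on `D(A)`. The two restrictions of `φ` satisfy it, by the Heisenberg relation in each
tensorand, so `φ` is multiplicative (`phi_mul`). Hence `φ^{⊗ n}` carries crossing operators to the
crossing operators of the actions through `φ`. With thick copies on the left of the orientation,
these actions are always `x ↦ left(x') right(x'')` and `f ↦ right(f') left(f'')` in terms of the
left and right copy of the strand (`pairAlg_apply`, `pairDual_apply`). Applying `Δ` in both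
tensorands of `R` splits such a crossing into four (`pairing_eq_four`), in the order in which the
duplicated crossings are read (`readCrossings_duplicate`). The two invariants thus agree crossing by
crossing, and no braid relation in `H(A)` is needed. -/

namespace HopfDouble

noncomputable section

open Coalgebra HopfAlgebra WithConv

/-! ### The canonical element of `A ⊗ A^*` and the Yang–Baxter equation. -/

section Pairing

variable {k A M : Type*} [Field k] [Ring A] [HopfAlgebra k A] [Ring M] [Algebra k M]

/-- The transpose `f ↦ f ∘ T` of an endomorphism of `A`. -/
def dualTranspose (T : A →ₗ[k] A) : DualAlgebra k A →ₗ[k] DualAlgebra k A where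
  toFun f := toConv (f.ofConv ∘ₗ T)
  map_add' _ _ := rfl
  map_smul' _ _ := rfl

@[simp] theorem dualTranspose_apply (T : A →ₗ[k] A) (f : DualAlgebra k A) (x : A) :
    (dualTranspose T f).ofConv x = f.ofConv (T x) := rfl

variable (k A) in
/-- The map `y ↦ (f ↦ f(y ?))`. -/
def frontHit : A →ₗ[k] Module.End k (DualAlgebra k A) :=
  LinearMap.mk₂ k (fun y g => toConv (g.ofConv ∘ₗ LinearMap.mulLeft k y))
    (fun a b g => by ext x; simp [add_mul])
    (fun c a g => by ext x; simp)
    (fun a g h => by ext x; simp)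
    (fun c a g => by ext x; simp)

@[simp] theorem frontHit_apply (y x : A) (f : DualAlgebra k A) :
    (frontHit k A y f).ofConv x = f.ofConv (y * x) := rfl

theorem dualTranspose_mulRight (a : A) : dualTranspose (LinearMap.mulRight k a) = hitRight k A a :=
  rfl

theorem dualTranspose_mulLeft (a : A) : dualTranspose (LinearMap.mulLeft k a) = frontHit k A a :=
  rfl

theorem sum_repr_eq {V : Type*} [AddCommGroup V] [Module k V] {x : A} {ι : Type*}
    (B : A →ₗ[k] A →ₗ[k] V) (r : Coalgebra.Repr k x ι) :
    ∑ i ∈ r.index, B (r.left i) (r.right i) = TensorProduct.lift B (comul x) := by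
  rw [← r.eq, map_sum]
  rfl

/-- `a ⊗ f ↦ α(a) β(f)`. -/
def evalPair (α : A →ₗ[k] M) (β : DualAlgebra k A →ₗ[k] M) : A ⊗[k] DualAlgebra k A →ₗ[k] M :=
  TensorProduct.lift ((LinearMap.mul k M).compl₁₂ α β)

@[simp] theorem evalPair_tmul (α : A →ₗ[k] M) (β : DualAlgebra k A →ₗ[k] M) (a : A)
    (f : DualAlgebra k A) : evalPair α β (a ⊗ₜ f) = α a * β f := rfl

/-- The exchange relation `∑ α(x') β(f(x'' ?)) = ∑ β(f(? x')) α(x'')` of the Drinfeld double. -/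
def Exchange (α : A →ₗ[k] M) (β : DualAlgebra k A →ₗ[k] M) : Prop :=
  ∀ (x : A) (f : DualAlgebra k A),
    ∑ i ∈ (ℛ k x).index, α ((ℛ k x).left i) * β (frontHit k A ((ℛ k x).right i) f) =
      ∑ i ∈ (ℛ k x).index, β (hitRight k A ((ℛ k x).left i) f) * α ((ℛ k x).right i)

theorem sum_mul_frontHit (α : A →ₗ[k] M) (β : DualAlgebra k A →ₗ[k] M) (f : DualAlgebra k A)
    {x : A} {ι κ : Type*} (r : Coalgebra.Repr k x ι) (s : Coalgebra.Repr k x κ) :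
    ∑ i ∈ r.index, α (r.left i) * β (frontHit k A (r.right i) f) =
      ∑ i ∈ s.index, α (s.left i) * β (frontHit k A (s.right i) f) := by
  let B := (LinearMap.mul k M).compl₁₂ α (β ∘ₗ (frontHit k A).flip f)
  exact (sum_repr_eq B r).trans (sum_repr_eq B s).symm

theorem sum_hitRight_mul (α : A →ₗ[k] M) (β : DualAlgebra k A →ₗ[k] M) (f : DualAlgebra k A)
    {x : A} {ι κ : Type*} (r : Coalgebra.Repr k x ι) (s : Coalgebra.Repr k x κ) :
    ∑ i ∈ r.index, β (hitRight k A (r.left i) f) * α (r.right i) =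
      ∑ i ∈ s.index, β (hitRight k A (s.left i) f) * α (s.right i) := by
  let B := (LinearMap.mul k M).compl₁₂ (β ∘ₗ (hitRight k A).toLinearMap.flip f) α
  exact (sum_repr_eq B r).trans (sum_repr_eq B s).symm

/-- Sweedler sums do not depend on the representative of the coproduct. This freedom is needed for
`Δ(γ(x))`, written through a representative of `Δ(x)`. -/
theorem Exchange.repr {α : A →ₗ[k] M} {β : DualAlgebra k A →ₗ[k] M} (h : Exchange α β) {x : A}
    {ι : Type*} (r : Coalgebra.Repr k x ι) (f : DualAlgebra k A) :
    ∑ i ∈ r.index, α (r.left i) * β (frontHit k A (r.right i) f) =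
      ∑ i ∈ r.index, β (hitRight k A (r.left i) f) * α (r.right i) := by
  rw [sum_mul_frontHit α β f r (ℛ k x), h, sum_hitRight_mul α β f _ r]

theorem commute_evalPair {m : M} {α : A →ₗ[k] M} {β : DualAlgebra k A →ₗ[k] M}
    (hα : ∀ x, Commute m (α x)) (hβ : ∀ f, Commute m (β f)) (t : A ⊗[k] DualAlgebra k A) :
    Commute m (evalPair α β t) := by
  induction t with
  | zero => simp
  | tmul x f => exact (hα x).mul_right (hβ f)
  | add s t hs ht => rw [map_add]; exact hs.add_right ht

variable [FiniteDimensional k A]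

theorem dual_eq_sum (f : DualAlgebra k A) :
    f = ∑ l, f.ofConv (Module.finBasis k A l) • toConv ((Module.finBasis k A).coord l) := by
  apply WithConv.ext
  rw [WithConv.ofConv_sum]
  refine (Module.finBasis k A).ext fun j => ?_
  simp

/-- `∑_a α(e_a) β(e^a)`. -/
def pairing (α : A →ₗ[k] M) (β : DualAlgebra k A →ₗ[k] M) : M :=
  ∑ i, α (Module.finBasis k A i) * β (toConv ((Module.finBasis k A).coord i))

/-- The canonical element is the identity of `A` viewed in `A ⊗ A^*`, so an endomorphism may act on
either tensorand. In coordinates both sides are the same double sum over the matrix of `T`. -/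
theorem canonicalElement_transpose {X Y : Type*} [Ring X] [Algebra k X] [Ring Y] [Algebra k Y]
    (α : A →ₗ[k] X) (β : DualAlgebra k A →ₗ[k] Y) (T : A →ₗ[k] A) :
    canonicalElement (α ∘ₗ T) β = canonicalElement α (β ∘ₗ dualTranspose T) := by
  set e := Module.finBasis k A with he
  have h1 (i) : α (T (e i)) = ∑ j, e.coord j (T (e i)) • α (e j) := by
    conv_lhs => rw [← e.sum_repr (T (e i))]
    simp only [map_sum, map_smul, Module.Basis.coord_apply]
  have h2 (j) : β (dualTranspose T (toConv (e.coord j))) =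
      ∑ i, e.coord j (T (e i)) • β (toConv (e.coord i)) := by
    conv_lhs => rw [dual_eq_sum (dualTranspose T (toConv (e.coord j)))]
    simp [← he]
  simp only [canonicalElement, ← he, LinearMap.comp_apply, h1, h2, TensorProduct.sum_tmul,
    TensorProduct.tmul_sum, TensorProduct.smul_tmul]
  exact Finset.sum_comm

theorem evalPair_canonicalElement (P : A →ₗ[k] A) (E : DualAlgebra k A →ₗ[k] DualAlgebra k A)
    (α : A →ₗ[k] M) (β : DualAlgebra k A →ₗ[k] M) :
    evalPair α β (canonicalElement P E) = pairing (α ∘ₗ P) (β ∘ₗ E) := by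
  simp [canonicalElement, pairing]

theorem mul'_canonicalElement (α : A →ₗ[k] M) (β : DualAlgebra k A →ₗ[k] M) :
    LinearMap.mul' k M (canonicalElement α β) = pairing α β := by
  simp [canonicalElement, pairing]

theorem pairing_transpose (α : A →ₗ[k] M) (β : DualAlgebra k A →ₗ[k] M) (T : A →ₗ[k] A) :
    pairing (α ∘ₗ T) β = pairing α (β ∘ₗ dualTranspose T) := by
  rw [← mul'_canonicalElement, canonicalElement_transpose, mul'_canonicalElement]

/-- This is `(Δ ⊗ 1)(R) = R₁₃R₂₃`: apply `β` to the second tensorand of `canonicalElement_mul` and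
multiply out. The commutation hypothesis brings the two labels from `A` next to each other. -/
theorem pairing_mul_pairing (P Q : A →ₗ[k] M) (β : DualAlgebra k A →ₐ[k] M)
    (h : ∀ x f, Commute (Q x) (β f)) :
    pairing P β.toLinearMap * pairing Q β.toLinearMap =
      pairing (toConv P * toConv Q).ofConv β.toLinearMap := by
  have key := congrArg (LinearMap.mul' k M ∘ₗ TensorProduct.map .id β.toLinearMap)
    (canonicalElement_mul P Q (AlgHom.id k (DualAlgebra k A)))
  have h1 (P : A →ₗ[k] M) : (LinearMap.mul' k M ∘ₗ TensorProduct.map .id β.toLinearMap)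
      (canonicalElement P (AlgHom.id k (DualAlgebra k A)).toLinearMap) =
      pairing P β.toLinearMap := by
    simp [canonicalElement, pairing]
  rw [h1] at key
  rw [← key]
  simp only [canonicalElement, pairing, Finset.sum_mul_sum, map_sum, LinearMap.comp_apply,
    Algebra.TensorProduct.tmul_mul_tmul, TensorProduct.map_tmul, LinearMap.id_apply,
    AlgHom.toLinearMap_apply, AlgHom.id_apply, LinearMap.mul'_apply, map_mul]
  refine Finset.sum_congr rfl fun i _ => Finset.sum_congr rfl fun j _ => ?_
  rw [mul_assoc, ← mul_assoc (β _), ← (h _ _).eq]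
  simp only [mul_assoc]

theorem mul_pairing (m : M) (α : A →ₗ[k] M) (β : DualAlgebra k A →ₗ[k] M) :
    m * pairing α β = pairing (LinearMap.mulLeft k m ∘ₗ α) β := by
  simp [pairing, Finset.mul_sum, mul_assoc]

theorem pairing_mul (m : M) (α : A →ₗ[k] M) (β : DualAlgebra k A →ₗ[k] M)
    (h : ∀ f, Commute m (β f)) :
    pairing α β * m = pairing (LinearMap.mulRight k m ∘ₗ α) β := by
  simp only [pairing, Finset.sum_mul, mul_assoc, LinearMap.comp_apply, LinearMap.mulRight_apply,
    (h _).eq]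

theorem commute_pairing {m : M} {α : A →ₗ[k] M} {β : DualAlgebra k A →ₗ[k] M}
    (hα : ∀ x, Commute m (α x)) (hβ : ∀ f, Commute m (β f)) : Commute m (pairing α β) :=
  Commute.sum_right _ _ _ fun _ _ => (hα _).mul_right (hβ _)

/-- `R Δ(x) = Δ^op(x) R`. -/
theorem pairing_mul_conv (α₁ α₂ : A →ₐ[k] M) (β₂ : DualAlgebra k A →ₐ[k] M)
    (h₁₁ : ∀ x y, Commute (α₁ x) (α₂ y)) (h₁₂ : ∀ x f, Commute (α₁ x) (β₂ f))
    (h : Exchange α₂.toLinearMap β₂.toLinearMap) (x : A) :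
    pairing α₁.toLinearMap β₂.toLinearMap *
        (toConv α₁.toLinearMap * toConv α₂.toLinearMap).ofConv x =
      (toConv α₂.toLinearMap * toConv α₁.toLinearMap).ofConv x *
        pairing α₁.toLinearMap β₂.toLinearMap := by
  -- Multiplying by `α₁ y` replaces `e_a` by `e_a y` (by `y e_a` in `h3`); the transpose then moves
  -- this translation onto `e^a`.
  have h2 (y : A) : pairing α₁.toLinearMap β₂.toLinearMap * α₁ y =
      pairing α₁.toLinearMap (β₂.toLinearMap ∘ₗ hitRight k A y) := by
    rw [pairing_mul _ _ _ (h₁₂ y), ← dualTranspose_mulRight, ← pairing_transpose]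
    congr 1
    ext z
    simp
  have h3 (y : A) : α₁ y * pairing α₁.toLinearMap β₂.toLinearMap =
      pairing α₁.toLinearMap (β₂.toLinearMap ∘ₗ frontHit k A y) := by
    rw [mul_pairing, ← dualTranspose_mulLeft, ← pairing_transpose]
    congr 1
    ext z
    simp
  have e1 := (ℛ k x).convMul_apply (toConv α₁.toLinearMap) (toConv α₂.toLinearMap)
  have e2 := (ℛ k x).convMul_apply (toConv α₂.toLinearMap) (toConv α₁.toLinearMap)
  refine (congrArg _ e1).trans (Eq.trans ?_ (congrArg (· * _) e2).symm)
  change _ * ∑ i ∈ (ℛ k x).index, α₁ ((ℛ k x).left i) * α₂ ((ℛ k x).right i) =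
    (∑ i ∈ (ℛ k x).index, α₂ ((ℛ k x).left i) * α₁ ((ℛ k x).right i)) * _
  simp only [Finset.mul_sum, Finset.sum_mul, ← mul_assoc, h2]
  simp only [mul_assoc, h3]
  simp only [pairing, Finset.mul_sum, Finset.sum_mul]
  rw [Finset.sum_comm, Finset.sum_comm (s := (ℛ k x).index)]
  refine Finset.sum_congr rfl fun a _ => ?_
  -- For each basis vector, what remains is the exchange relation for `e^a`, multiplied by
  -- `α₁(e_a)`.
  have := congrArg (α₁ (Module.finBasis k A a) * ·)
    (h x (toConv ((Module.finBasis k A).coord a)))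
  simp only [Finset.mul_sum] at this
  simp only [AlgHom.toLinearMap_apply, LinearMap.comp_apply, mul_assoc] at this ⊢
  rw [← this]
  refine Finset.sum_congr rfl fun i _ => ?_
  rw [← mul_assoc, ← mul_assoc, (h₁₁ _ _).eq]

/-- The Yang–Baxter equation. -/
theorem pairing_yangBaxter (α₁ α₂ : A →ₐ[k] M) (β₂ β₃ : DualAlgebra k A →ₐ[k] M)
    (h₁ : ∀ x y, Commute (α₁ x) (α₂ y)) (h₂ : ∀ x f, Commute (α₁ x) (β₂ f))
    (h₃ : ∀ x f, Commute (α₁ x) (β₃ f)) (h₄ : ∀ x f, Commute (α₂ x) (β₃ f))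
    (h₅ : ∀ f g, Commute (β₂ f) (β₃ g))
    (h : Exchange α₂.toLinearMap β₂.toLinearMap) :
    pairing α₁.toLinearMap β₂.toLinearMap * (pairing α₁.toLinearMap β₃.toLinearMap *
        pairing α₂.toLinearMap β₃.toLinearMap) =
      pairing α₂.toLinearMap β₃.toLinearMap * (pairing α₁.toLinearMap β₃.toLinearMap *
        pairing α₁.toLinearMap β₂.toLinearMap) := by
  -- Both sides become pairings with `β₃`, as `R₁₃R₂₃` and `R₂₃R₁₃` are `Δ` and `Δ^op` applied to
  -- the first tensorand of `R`. It remains to compare the maps on `A`, which is `R₁₂Δ(x) =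
  -- Δ^op(x)R₁₂`.
  rw [pairing_mul_pairing _ _ _ h₄, ← mul_assoc, pairing_mul_pairing _ _ _ h₃, mul_pairing,
    pairing_mul]
  · congr 1
    ext x
    exact pairing_mul_conv α₁ α₂ β₂ h₁ h₂ h x
  · exact fun f => (commute_pairing (fun x => (h₃ x f).symm) (fun g => (h₅ g f).symm)).symm

variable (k A) in
/-- The canonical element of `A ⊗ A^*`, which is invertible. -/
def universalUnit : (A ⊗[k] DualAlgebra k A)ˣ :=
  canonicalUnit (AlgHom.id k A) (AlgHom.id k (DualAlgebra k A))

/-- The operator `∑_a α(e_a) β(e^a)` of a positive crossing, or `∑_a α(γ(e_a)) β(e^a)` of a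
negative one. -/
def crossOp (α : A →ₗ[k] M) (β : DualAlgebra k A →ₗ[k] M) (b : Bool) : M :=
  evalPair α β (signed (universalUnit k A) b)

theorem crossOp_true (α : A →ₗ[k] M) (β : DualAlgebra k A →ₗ[k] M) :
    crossOp α β true = pairing α β :=
  evalPair_canonicalElement _ _ α β

/-- For commuting actions `evalPair` is an algebra homomorphism on `A ⊗ A^*`, so it carries the
inverse of `universalUnit` to an inverse. -/
theorem crossOp_mul_crossOp_not (α : A →ₐ[k] M) (β : DualAlgebra k A →ₐ[k] M)
    (h : ∀ x f, Commute (α x) (β f)) (b : Bool) :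
    crossOp α.toLinearMap β.toLinearMap b * crossOp α.toLinearMap β.toLinearMap (!b) = 1 := by
  have h1 (t : A ⊗[k] DualAlgebra k A) : evalPair α.toLinearMap β.toLinearMap t =
      Algebra.TensorProduct.lift α β h t := rfl
  simp only [crossOp, h1, ← map_mul]
  cases b <;> simp [signed]

theorem commute_crossOp {α α' : A →ₗ[k] M} {β β' : DualAlgebra k A →ₗ[k] M}
    (h₁ : ∀ x y, Commute (α x) (α' y)) (h₂ : ∀ x f, Commute (α x) (β' f))
    (h₃ : ∀ x f, Commute (α' x) (β f)) (h₄ : ∀ f g, Commute (β f) (β' g)) (b b' : Bool) :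
    Commute (crossOp α β b) (crossOp α' β' b') :=
  (commute_evalPair (fun y => (commute_evalPair (fun x => (h₁ x y).symm)
      (fun f => h₃ y f) _).symm)
    (fun g => (commute_evalPair (fun x => (h₂ x g).symm) (fun f => (h₄ f g).symm) _).symm) _)

end Pairing

/-! ### The exchange relation as the universal property of the Drinfeld double. -/

section Universal

variable {k A M : Type*} [Field k] [Ring A] [HopfAlgebra k A] [Ring M] [Algebra k M]

theorem sum_sum_assoc {V : Type*} [AddCommGroup V] [Module k V]
    (Φ : A ⊗[k] (A ⊗[k] A) →ₗ[k] V) {x : A} {ι : Type*} {κ Λ : ι → Type*}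
    (r : Coalgebra.Repr k x ι) (s : ∀ i, Coalgebra.Repr k (r.left i) (κ i))
    (t : ∀ i, Coalgebra.Repr k (r.right i) (Λ i)) :
    ∑ i ∈ r.index, ∑ j ∈ (s i).index, Φ ((s i).left j ⊗ₜ ((s i).right j ⊗ₜ r.right i)) =
      ∑ i ∈ r.index, ∑ j ∈ (t i).index, Φ (r.left i ⊗ₜ ((t i).left j ⊗ₜ (t i).right j)) := by
  simpa only [map_sum] using congrArg Φ (sum_tmul_tmul_eq r s t)

theorem comul_four_right :
    TensorProduct.map .id (TensorProduct.assoc k A A A).toLinearMap ∘ₗ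
      (TensorProduct.assoc k A (A ⊗[k] A) A).toLinearMap ∘ₗ
      TensorProduct.map (TensorProduct.map .id comul ∘ₗ comul) .id ∘ₗ
      (comul : A →ₗ[k] A ⊗[k] A) =
    TensorProduct.map .id (TensorProduct.map .id comul) ∘ₗ TensorProduct.map .id comul ∘ₗ comul := by
  simp only [coassoc_simps]

theorem sum_smul_counit_map {V : Type*} [AddCommGroup V] [Module k V] (L : A →ₗ[k] V) {a : A}
    {ι : Type*} (r : Coalgebra.Repr k a ι) :
    ∑ i ∈ r.index, counit (R := k) (r.right i) • L (r.left i) = L a := by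
  simpa only [map_sum, map_smul] using congrArg L (sum_smul_counit r)

variable [InvertibleAntipode k A]

/-- Applying `γ`, which reverses products, turns this into `∑ x' γ(x'') = ε(x)`. -/
theorem sum_mul_antipodeInv {x : A} {ι : Type*} (r : Coalgebra.Repr k x ι) :
    ∑ i ∈ r.index, r.right i * antipodeInv k A (r.left i) = counit (R := k) x • 1 := by
  apply (InvertibleAntipode.bijective (k := k) (A := A)).injective
  simp only [map_sum, antipode_mul_antidistrib, antipode_antipodeInv, sum_mul_antipode_eq_smul r, map_smul,
    antipode_one]

theorem sum_antipodeInv_mul {x : A} {ι : Type*} (r : Coalgebra.Repr k x ι) :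
    ∑ i ∈ r.index, antipodeInv k A (r.right i) * r.left i = counit (R := k) x • 1 := by
  apply (InvertibleAntipode.bijective (k := k) (A := A)).injective
  simp only [map_sum, antipode_mul_antidistrib, antipode_antipodeInv, sum_antipode_mul_eq_smul r, map_smul,
    antipode_one]

/-- The exchange relation determines the product of the images of `A` and `A^*` as in the
Drinfeld double. -/
theorem Exchange.mul_eq {P : A →ₗ[k] M} {E : DualAlgebra k A →ₗ[k] M} (h : Exchange P E) (a : A)
    (g : DualAlgebra k A) :
    P a * E g = ∑ i ∈ (ℛ k a).index, ∑ j ∈ (ℛ k ((ℛ k a).right i)).index,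
      E (hitRight k A ((ℛ k a).left i) (hitLeft k A ((ℛ k ((ℛ k a).right i)).right j) g)) *
        P ((ℛ k ((ℛ k a).right i)).left j) := by
  let Φ₁ : A ⊗[k] (A ⊗[k] A) →ₗ[k] M := LinearMap.mul' k M ∘ₗ
    TensorProduct.map (E ∘ₗ TensorProduct.lift
      ((hitRight k A).toLinearMap.compl₂ ((hitLeft k A).toLinearMap.flip g))) P ∘ₗ
    (TensorProduct.assoc k A A A).symm.toLinearMap ∘ₗ
    TensorProduct.map .id (TensorProduct.comm k A A).toLinearMap
  have hΦ₁ (p u v : A) : Φ₁ (p ⊗ₜ (u ⊗ₜ v)) = E (hitRight k A p (hitLeft k A v g)) * P u := rfl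
  let Φ₂ : A ⊗[k] (A ⊗[k] A) →ₗ[k] M := LinearMap.mul' k M ∘ₗ
    TensorProduct.map P (E ∘ₗ TensorProduct.lift
      ((frontHit k A).compl₂ ((hitLeft k A).toLinearMap.flip g)))
  have hΦ₂ (p u v : A) : Φ₂ (p ⊗ₜ (u ⊗ₜ v)) = P p * E (frontHit k A u (hitLeft k A v g)) := rfl
  have h₁ := sum_sum_assoc Φ₁ (ℛ k a) (fun i => ℛ k _) (fun i => ℛ k _)
  have h₂ := sum_sum_assoc Φ₂ (ℛ k a) (fun i => ℛ k _) (fun i => ℛ k _)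
  simp only [hΦ₁, hΦ₂] at h₁ h₂
  have h₃ (u v : A) : frontHit k A u (hitLeft k A v g) = frontHit k A (antipodeInv k A v * u) g := by
    ext x
    simp [mul_assoc]
  have h₄ : frontHit k A 1 g = g := by ext x; simp
  -- With the left factor of `Δ(a)` split, `Exchange` moves `P` in front of `E`. With the right
  -- factor split instead, the two translations of `g` meet as `∑ γ⁻¹(a''') a''`, which collapses to
  -- the counit.
  rw [← h₁, ← Finset.sum_congr rfl fun i _ => h _ _, h₂]
  simp only [h₃, ← Finset.mul_sum, ← map_sum, ← LinearMap.sum_apply, sum_antipodeInv_mul, map_smul,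
    LinearMap.smul_apply, h₄, mul_smul_comm, ← smul_mul_assoc, ← Finset.sum_mul]
  rw [sum_smul_counit_map]

theorem DrinfeldDouble.ofDual_mul_ofAlg (f : DualAlgebra k A) (a : A) :
    ofDual k A f * ofAlg k A a = ofTensor k A (f ⊗ₜ a) := by
  change ofTensor k A (drinMul k A (f ⊗ₜ 1) (1 ⊗ₜ a)) = _
  rw [drinMul_tmul, map_one (drinAct k A), mul_one, leftMul_tmul, mul_one]

theorem DrinfeldDouble.ofAlg_mul_ofDual (a : A) (g : DualAlgebra k A) :
    ofAlg k A a * ofDual k A g =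
      ∑ i ∈ (ℛ k a).index, ∑ j ∈ (ℛ k ((ℛ k a).right i)).index,
        ofDual k A (hitRight k A ((ℛ k a).left i)
          (hitLeft k A ((ℛ k ((ℛ k a).right i)).right j) g)) *
        ofAlg k A ((ℛ k ((ℛ k a).right i)).left j) := by
  refine (ofTensor_mul_ofTensor 1 g a 1 (ℛ k a) (fun i => ℛ k _)).trans ?_
  simp only [one_mul, mul_one, ofDual_mul_ofAlg]

/-- This is the converse computation to `Exchange.mul_eq`. Expanding the product on the left gives
terms `f(x₄ γ⁻¹(x₃) ? x₁) ⊗ x₂` over the fourfold coproduct of `x`, and the last two factors cancel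
by `sum_mul_antipodeInv`. -/
theorem DrinfeldDouble.exchange :
    Exchange (ofAlg k A).toLinearMap (ofDual k A).toLinearMap := by
  intro x f
  let F : A ⊗[k] A →ₗ[k] DualAlgebra k A := (frontHit k A).flip f ∘ₗ LinearMap.mul' k A ∘ₗ
    (TensorProduct.comm k A A).toLinearMap ∘ₗ TensorProduct.map (antipodeInv k A) .id
  let Ψ : A ⊗[k] (A ⊗[k] (A ⊗[k] A)) →ₗ[k] DrinfeldDouble k A := LinearMap.mul' k _ ∘ₗ
    TensorProduct.map ((ofDual k A).toLinearMap ∘ₗ TensorProduct.lift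
      ((hitRight k A).toLinearMap.compl₂ F)) (ofAlg k A).toLinearMap ∘ₗ
    (TensorProduct.assoc k A (A ⊗[k] A) A).symm.toLinearMap ∘ₗ
    TensorProduct.map .id (TensorProduct.comm k A (A ⊗[k] A)).toLinearMap
  have hΨ (p u v z : A) : Ψ (p ⊗ₜ (u ⊗ₜ (v ⊗ₜ z))) =
    ofDual k A (hitRight k A p (frontHit k A (z * antipodeInv k A v) f)) * ofAlg k A u := rfl
  have key := congrArg Ψ (LinearMap.congr_fun (comul_four_right (k := k) (A := A)) x)
  have e1 : ∀ y : A, comul (R := k) y = ∑ i ∈ (ℛ k y).index, (ℛ k y).left i ⊗ₜ[k] (ℛ k y).right i :=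
    fun y => (ℛ k y).eq.symm
  simp only [LinearMap.comp_apply, e1 x, e1 ((ℛ k _).left _), e1 ((ℛ k _).right _), map_sum,
    TensorProduct.map_tmul, LinearMap.id_apply, TensorProduct.tmul_sum, TensorProduct.sum_tmul,
    LinearEquiv.coe_coe, TensorProduct.assoc_tmul, hΨ] at key
  have h₃ (u v : A) : hitLeft k A v (frontHit k A u f) = frontHit k A (u * antipodeInv k A v) f := by
    ext x
    simp [mul_assoc]
  have h₄ : frontHit k A 1 f = f := by ext x; simp
  simp only [AlgHom.toLinearMap_apply, ofAlg_mul_ofDual, h₃]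
  refine key.trans ?_
  simp only [← Finset.sum_mul, ← map_sum, ← LinearMap.sum_apply, sum_mul_antipodeInv, map_smul,
    LinearMap.smul_apply, h₄, smul_mul_assoc, ← mul_smul_comm, ← Finset.mul_sum]
  simp only [← AlgHom.toLinearMap_apply, sum_smul_counit_map]

/-- A linear map on `D(A)` that is given by algebra homomorphisms on `A^*` and `A` which satisfy the
exchange relation is multiplicative. -/
theorem DrinfeldDouble.map_mul_of_exchange (P : A →ₐ[k] M) (E : DualAlgebra k A →ₐ[k] M)
    (h : Exchange P.toLinearMap E.toLinearMap) (φ : DrinfeldDouble k A →ₗ[k] M)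
    (hφ : ∀ f a, φ (ofTensor k A (f ⊗ₜ a)) = E f * P a) (x y : DrinfeldDouble k A) :
    φ (x * y) = φ x * φ y := by
  obtain ⟨x, rfl⟩ := (ofTensor k A).surjective x
  obtain ⟨y, rfl⟩ := (ofTensor k A).surjective y
  induction x with
  | zero => simp
  | add x y hx hy => simp only [map_add, add_mul, hx, hy]
  | tmul f a =>
    induction y with
    | zero => simp
    | add x y hx hy => simp only [map_add, mul_add, hx, hy]
    | tmul g b =>
      have := h.mul_eq a g
      simp only [AlgHom.toLinearMap_apply] at this
      rw [ofTensor_mul_ofTensor f g a b (ℛ k a) (fun i => ℛ k _), hφ, hφ, mul_assoc,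
        ← mul_assoc (P a), this]
      simp only [map_sum, hφ, map_mul, Finset.mul_sum, Finset.sum_mul, mul_assoc]

end Universal

/-! ### The Heisenberg double and the multiplicativity of `φ`. -/

section Heisenberg

variable {k A : Type*} [Field k] [Ring A] [HopfAlgebra k A]

theorem HeisenbergDouble.ofDual_mul_ofAlg (f : DualAlgebra k A) (a : A) :
    ofDual k A f * ofAlg k A a = ofTensor k A (f ⊗ₜ a) := by
  change ofTensor k A (heisMul k A (f ⊗ₜ 1) (1 ⊗ₜ a)) = _
  rw [heisMul_tmul, map_one (heisAct k A), mul_one, leftMul_tmul, mul_one]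

theorem HeisenbergDouble.ofAlg_mul_ofDual (a : A) (g : DualAlgebra k A) {ι : Type*}
    (r : Coalgebra.Repr k a ι) :
    ofAlg k A a * ofDual k A g =
      ∑ i ∈ r.index, ofDual k A (hitRight k A (r.left i) g) * ofAlg k A (r.right i) := by
  refine (ofTensor_mul_ofTensor 1 g a 1 r).trans ?_
  simp only [one_mul, mul_one, ofDual_mul_ofAlg]

theorem frontHit_hitRight (x y : A) (f : DualAlgebra k A) :
    frontHit k A x (hitRight k A y f) = hitRight k A y (frontHit k A x f) := by
  ext z
  simp [mul_assoc]

/-- The coproduct of `γ(x)` is `∑ γ(x'') ⊗ γ(x')`. -/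
def antipodeRepr {x : A} {ι : Type*} (r : Coalgebra.Repr k x ι) :
    Coalgebra.Repr k (antipode k x) ι where
  index := r.index
  left i := antipode k (r.right i)
  right i := antipode k (r.left i)
  eq := by
    have := LinearMap.congr_fun (comul_comp_antipode (k := k) (A := A)) x
    simp only [LinearMap.comp_apply, ← r.eq] at this
    simp [this]

variable (k A) in
/-- The restriction of `φ` to `A`. -/
def phiAlg : A →ₐ[k] HeisenbergDouble k A ⊗[k] (HeisenbergDouble k A)ᵐᵒᵖ :=
  (Algebra.TensorProduct.map (HeisenbergDouble.ofAlg k A) (twistedAlg k A)).comp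
    (Bialgebra.comulAlgHom k A)

theorem phiAlg_apply (x : A) {ι : Type*} (r : Coalgebra.Repr k x ι) :
    phiAlg k A x = ∑ i ∈ r.index, HeisenbergDouble.ofAlg k A (r.left i) ⊗ₜ
      MulOpposite.op (HeisenbergDouble.ofAlg k A (antipode k (r.right i))) := by
  simp only [phiAlg, AlgHom.comp_apply, Bialgebra.comulAlgHom_apply, ← r.eq, map_sum]
  rfl

section FiniteDimensional

variable [FiniteDimensional k A]

theorem comulDual_apply (f : DualAlgebra k A) :
    comulDual k A f = ∑ i, hitRight k A (Module.finBasis k A i) f ⊗ₜ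
      toConv ((Module.finBasis k A).coord i) := by
  simp [comulDual]

theorem comulDual_eq_canonicalElement (f : DualAlgebra k A) :
    comulDual k A f = canonicalElement ((hitRight k A).toLinearMap.flip f)
      (AlgHom.id k (DualAlgebra k A)).toLinearMap := by
  simp [comulDual_apply, canonicalElement]

theorem comulDual_mul (f g : DualAlgebra k A) :
    comulDual k A (f * g) = comulDual k A f * comulDual k A g := by
  simp only [comulDual_eq_canonicalElement, canonicalElement_mul]
  congr 1
  ext1 a
  refine (hitRight_mul a f g (ℛ k a)).trans ?_
  exact ((ℛ k a).convMul_apply (toConv ((hitRight k A).toLinearMap.flip f))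
    (toConv ((hitRight k A).toLinearMap.flip g))).symm

theorem comulDual_one : comulDual k A 1 = 1 := by
  rw [comulDual_eq_canonicalElement, ← canonicalElement_one (AlgHom.id k (DualAlgebra k A))]
  congr 1
  ext1 a
  exact (hitRight_one a).trans (by simp [Algebra.algebraMap_eq_smul_one])

variable (k A) in
/-- The coproduct of `A^*` as an algebra homomorphism. -/
def comulDualAlgHom : DualAlgebra k A →ₐ[k] DualAlgebra k A ⊗[k] DualAlgebra k A :=
  AlgHom.ofLinearMap (comulDual k A) comulDual_one comulDual_mul

theorem comulDual_hitRight (x : A) (f : DualAlgebra k A) :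
    comulDual k A (hitRight k A x f) = TensorProduct.map .id (hitRight k A x) (comulDual k A f) := by
  have h := canonicalElement_transpose ((hitRight k A).toLinearMap.flip f)
    (AlgHom.id k (DualAlgebra k A)).toLinearMap (LinearMap.mulRight k x)
  rw [comulDual_eq_canonicalElement, comulDual_apply]
  refine Eq.trans (congrArg (canonicalElement · _) ?_) (h.trans ?_)
  · ext1 y
    simp
  · simp [canonicalElement, dualTranspose_mulRight]

theorem comulDual_frontHit (x : A) (f : DualAlgebra k A) :
    comulDual k A (frontHit k A x f) = TensorProduct.map (frontHit k A x) .id (comulDual k A f) := by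
  simp [comulDual_apply, frontHit_hitRight]

end FiniteDimensional

variable [InvertibleAntipode k A]

theorem dualAntipodeInv_frontHit (x : A) (f : DualAlgebra k A) :
    dualAntipodeInv k A (frontHit k A x f) =
      hitRight k A (antipode k x) (dualAntipodeInv k A f) := by
  ext z
  simp [dualAntipodeInv_apply, antipodeInv_mul]

theorem dualAntipodeInv_hitRight (x : A) (f : DualAlgebra k A) :
    dualAntipodeInv k A (hitRight k A x f) =
      frontHit k A (antipode k x) (dualAntipodeInv k A f) := by
  ext z
  simp [dualAntipodeInv_apply, antipodeInv_mul]

/-- For `t = p ⊗ q` both sides equal `∑ x' q ⊗ γ(x'') (γ⁻¹)^*(p)`, with the products taken in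
`H(A)`: the right side by the Heisenberg relation for `x'` in the first tensorand, the left side by
that for `γ(x'')` in the second. A general `t` stands for `Δ(f)`, which is not a pure tensor. -/
theorem phiAlg_phiDual_exchange_aux (x : A) (t : DualAlgebra k A ⊗[k] DualAlgebra k A) :
    ∑ i ∈ (ℛ k x).index, phiAlg k A ((ℛ k x).left i) *
        TensorProduct.map (HeisenbergDouble.ofDual k A).toLinearMap (twistedDual k A).toLinearMap
          (TensorProduct.comm k _ _
            (TensorProduct.map (frontHit k A ((ℛ k x).right i)) .id t)) =
      ∑ i ∈ (ℛ k x).index,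
        TensorProduct.map (HeisenbergDouble.ofDual k A).toLinearMap (twistedDual k A).toLinearMap
          (TensorProduct.comm k _ _
            (TensorProduct.map .id (hitRight k A ((ℛ k x).left i)) t)) *
        phiAlg k A ((ℛ k x).right i) := by
  induction t with
  | zero => simp
  | add s t hs ht => simp only [map_add, mul_add, add_mul, Finset.sum_add_distrib, hs, ht]
  | tmul p q =>
    set p' := dualAntipodeInv k A p with hp'
    let ofA := (HeisenbergDouble.ofAlg k A).toLinearMap
    let ofD := (HeisenbergDouble.ofDual k A).toLinearMap
    let op' := (MulOpposite.opLinearEquiv k (M := HeisenbergDouble k A)).toLinearMap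
    let Φ₁ : A ⊗[k] (A ⊗[k] A) →ₗ[k] HeisenbergDouble k A ⊗[k] (HeisenbergDouble k A)ᵐᵒᵖ :=
      TensorProduct.map (LinearMap.mulRight k (ofD q) ∘ₗ ofA)
        (op' ∘ₗ LinearMap.mul' k _ ∘ₗ TensorProduct.map
          (ofD ∘ₗ (hitRight k A).toLinearMap.flip p' ∘ₗ antipode k) (ofA ∘ₗ antipode k) ∘ₗ
          (TensorProduct.comm k A A).toLinearMap)
    have hΦ₁ (a b c : A) : Φ₁ (a ⊗ₜ (b ⊗ₜ c)) = (ofA a * ofD q) ⊗ₜ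
      MulOpposite.op (ofD (hitRight k A (antipode k c) p') * ofA (antipode k b)) := rfl
    let Φ₂ : A ⊗[k] (A ⊗[k] A) →ₗ[k] HeisenbergDouble k A ⊗[k] (HeisenbergDouble k A)ᵐᵒᵖ :=
      TensorProduct.map (LinearMap.mul' k _ ∘ₗ TensorProduct.map
          (ofD ∘ₗ (hitRight k A).toLinearMap.flip q) ofA)
        (op' ∘ₗ LinearMap.mulRight k (ofD p') ∘ₗ ofA ∘ₗ antipode k) ∘ₗ
      (TensorProduct.assoc k A A A).symm.toLinearMap
    have hΦ₂ (a b c : A) : Φ₂ (a ⊗ₜ (b ⊗ₜ c)) = (ofD (hitRight k A a q) * ofA b) ⊗ₜ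
      MulOpposite.op (ofA (antipode k c) * ofD p') := rfl
    have h₁ := sum_sum_assoc Φ₁ (ℛ k x) (fun i => ℛ k _) (fun i => ℛ k _)
    have h₂ := sum_sum_assoc Φ₂ (ℛ k x) (fun i => ℛ k _) (fun i => ℛ k _)
    simp only [hΦ₁, hΦ₂] at h₁ h₂
    have e₁ (y : A) : ∑ i ∈ (ℛ k y).index, ofD (hitRight k A ((ℛ k y).left i) q) *
        ofA ((ℛ k y).right i) = ofA y * ofD q :=
      (HeisenbergDouble.ofAlg_mul_ofDual y q (ℛ k y)).symm
    -- As `Δ(γ(y)) = ∑ γ(y'') ⊗ γ(y')`, this is again the Heisenberg relation, and the reversed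
    -- order of the factors is the one produced by multiplication in `H(A)^op`.
    have e₂ (y : A) : ∑ i ∈ (ℛ k y).index,
        ofD (hitRight k A (antipode k ((ℛ k y).right i)) p') * ofA (antipode k ((ℛ k y).left i)) =
          ofA (antipode k y) * ofD p' :=
      (HeisenbergDouble.ofAlg_mul_ofDual (antipode k y) p' (antipodeRepr (ℛ k y))).symm
    refine Eq.trans ?_ (h₁.trans (Eq.trans ?_ (h₂.trans ?_)))
    · refine Finset.sum_congr rfl fun i _ => ?_
      rw [phiAlg_apply _ (ℛ k _), Finset.sum_mul]
      refine Finset.sum_congr rfl fun j _ => ?_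
      refine (Algebra.TensorProduct.tmul_mul_tmul _ _ _ _).trans ?_
      refine congrArg (fun z => _ ⊗ₜ MulOpposite.op (ofD z * _)) ?_
      exact dualAntipodeInv_frontHit _ p
    · refine Finset.sum_congr rfl fun i _ => ?_
      rw [← TensorProduct.tmul_sum, ← TensorProduct.sum_tmul, ← Finset.op_sum, e₁, e₂]
    · refine Finset.sum_congr rfl fun i _ => ?_
      rw [phiAlg_apply _ (ℛ k _), Finset.mul_sum]
      refine Finset.sum_congr rfl fun j _ => ?_
      exact (Algebra.TensorProduct.tmul_mul_tmul _ _ _ _).symm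

variable [FiniteDimensional k A]

theorem comulDual_dualAntipodeInv (f : DualAlgebra k A) :
    comulDual k A (dualAntipodeInv k A f) =
      TensorProduct.map (dualAntipodeInv k A) (dualAntipodeInv k A)
        (TensorProduct.comm k _ _ (comulDual k A f)) := by
  have h := canonicalElement_transpose (dualAntipodeInv k A ∘ₗ (frontHit k A).flip f)
    (AlgHom.id k (DualAlgebra k A)).toLinearMap (antipodeInv k A)
  -- `comulDual` expands `Δ(f)` along the dual basis in the second tensorand. Since `γ⁻¹` reverses
  -- products, the expansion along the first one, `∑ e^a ⊗ f(e_a ?)`, is needed here.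
  have h' : comulDual k A f = TensorProduct.comm k _ _ (canonicalElement ((frontHit k A).flip f)
      (AlgHom.id k (DualAlgebra k A)).toLinearMap) := by
    set e := Module.finBasis k A with he
    have h1 (i) : hitRight k A (e i) f = ∑ j, f.ofConv (e j * e i) • toConv (e.coord j) := by
      rw [dual_eq_sum (hitRight k A (e i) f)]
      simp [← he]
    have h2 (j) : frontHit k A (e j) f = ∑ i, f.ofConv (e j * e i) • toConv (e.coord i) := by
      rw [dual_eq_sum (frontHit k A (e j) f)]
      simp [← he]
    simp only [comulDual_apply, canonicalElement, ← he, h1, TensorProduct.sum_tmul, map_sum,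
      LinearMap.flip_apply, h2, TensorProduct.comm_tmul,
      AlgHom.toLinearMap_apply, AlgHom.id_apply, TensorProduct.smul_tmul]
    exact Finset.sum_comm
  rw [h', comulDual_eq_canonicalElement]
  refine Eq.trans (congrArg (canonicalElement · _) ?_) (h.trans ?_)
  · ext1 y
    refine WithConv.ext (LinearMap.ext fun z => ?_)
    simp [dualAntipodeInv_apply, antipodeInv_mul]
  · simp only [canonicalElement, map_sum]
    simp
    rfl

variable (k A) in
/-- The restriction of `φ` to `A^*`. -/
def phiDual : DualAlgebra k A →ₐ[k] HeisenbergDouble k A ⊗[k] (HeisenbergDouble k A)ᵐᵒᵖ :=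
  ((Algebra.TensorProduct.map (HeisenbergDouble.ofDual k A) (twistedDual k A)).comp
    (Algebra.TensorProduct.comm k _ _).toAlgHom).comp (comulDualAlgHom k A)

theorem phiDual_apply (f : DualAlgebra k A) :
    phiDual k A f = TensorProduct.map (HeisenbergDouble.ofDual k A).toLinearMap
        (twistedDual k A).toLinearMap (TensorProduct.comm k _ _ (comulDual k A f)) := rfl

theorem phi_ofTensor (f : DualAlgebra k A) (a : A) :
    phi k A (DrinfeldDouble.ofTensor k A (f ⊗ₜ a)) = phiDual k A f * phiAlg k A a := rfl

theorem phiAlg_phiDual_exchange :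
    Exchange (phiAlg k A).toLinearMap (phiDual k A).toLinearMap := by
  intro x f
  simp only [AlgHom.toLinearMap_apply, phiDual_apply, comulDual_frontHit, comulDual_hitRight]
  exact phiAlg_phiDual_exchange_aux x (comulDual k A f)

theorem phi_mul (x y : DrinfeldDouble k A) : phi k A (x * y) = phi k A x * phi k A y :=
  DrinfeldDouble.map_mul_of_exchange (phiAlg k A) (phiDual k A) phiAlg_phiDual_exchange (phi k A)
    phi_ofTensor x y

theorem phi_one : phi k A 1 = 1 := by
  rw [DrinfeldDouble.one_def, phi_ofTensor, map_one, map_one, mul_one]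

variable (k A) in
/-- `φ` as an algebra homomorphism. -/
def phiAlgHom : DrinfeldDouble k A →ₐ[k] HeisenbergDouble k A ⊗[k] (HeisenbergDouble k A)ᵐᵒᵖ :=
  AlgHom.ofLinearMap (phi k A) phi_one phi_mul

theorem phi_ofAlg (a : A) : phi k A (DrinfeldDouble.ofAlg k A a) = phiAlg k A a := by
  refine (phi_ofTensor 1 a).trans ?_
  rw [map_one, one_mul]

theorem phi_ofDual (f : DualAlgebra k A) : phi k A (DrinfeldDouble.ofDual k A f) = phiDual k A f := by
  refine (phi_ofTensor f 1).trans ?_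
  rw [map_one, mul_one]

end Heisenberg

/-! ### Oriented strands as actions of `A` and `A^*`. -/

section Strands

variable {k A W : Type*} [Field k] [Ring A] [HopfAlgebra k A] [Ring W] [Algebra k W]

@[simp] theorem writeLabel_down_apply (x w : W) : writeLabel (k := k) .down x w = x * w := rfl

@[simp] theorem writeLabel_up_apply (x w : W) : writeLabel (k := k) .up x w = w * x := rfl

/-- Multiplications on opposite sides commute by associativity; those on the same side commute
because the labels do. -/
theorem writeLabel_commute {x y : W} (h : Commute x y) (d d' : Dir) :
    Commute (writeLabel (k := k) d x) (writeLabel (k := k) d' y) := by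
  refine LinearMap.ext fun w => ?_
  cases d <;> cases d' <;> simp only [Module.End.mul_apply, writeLabel_down_apply,
    writeLabel_up_apply, mul_assoc]
  · rw [← mul_assoc, h.eq, mul_assoc]
  · rw [h.eq]

/-- The action of `A` by labels on a strand: `x` is written if the strand is oriented downwards and
`γ(x)` if it is oriented upwards. -/
def strandAlg (ι : A →ₐ[k] W) (d : Dir) : A →ₐ[k] Module.End k W :=
  AlgHom.ofLinearMap (writeLabel d ∘ₗ ι.toLinearMap ∘ₗ twistLabel (antipode k) d)
    (by ext w; cases d <;> simp [twistLabel])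
    -- On an upward strand both right multiplication and `γ` reverse products, so their composite
    -- preserves them.
    (fun a b => by ext w; cases d <;> simp [twistLabel, mul_assoc, antipode_mul_antidistrib])

theorem strandAlg_apply (ι : A →ₐ[k] W) (d : Dir) (x : A) :
    strandAlg ι d x = writeLabel d (ι (twistLabel (antipode k) d x)) := rfl

theorem HeisenbergDouble.mapAntipode_ofAlg (x : A) :
    mapAntipode k A (ofAlg k A x) = ofAlg k A (HopfAlgebra.antipode k x) := rfl

theorem signed_canonicalUnit [FiniteDimensional k A] {X Y : Type*} [Ring X] [Algebra k X] [Ring Y] [Algebra k Y]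
    (P : A →ₐ[k] X) (E : DualAlgebra k A →ₐ[k] Y) (b : Bool) :
    signed (canonicalUnit P E) b =
      TensorProduct.map P.toLinearMap E.toLinearMap (signed (universalUnit k A) b) := by
  cases b <;> simp [signed, canonicalUnit, universalUnit, canonicalElement]

variable [InvertibleAntipode k A]

/-- The action of `A^*` by labels on a strand: `f` is written if the strand is oriented downwards
and `(γ⁻¹)^*(f)` if it is oriented upwards. -/
def strandDual (ι : DualAlgebra k A →ₐ[k] W) (d : Dir) : DualAlgebra k A →ₐ[k] Module.End k W :=
  AlgHom.ofLinearMap (writeLabel d ∘ₗ ι.toLinearMap ∘ₗ twistLabel (dualAntipodeInv k A) d)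
    (by ext w; cases d <;> simp [twistLabel, dualAntipodeInv_one])
    (fun a b => by ext w; cases d <;> simp [twistLabel, mul_assoc, dualAntipodeInv_mul])

theorem strandDual_apply (ι : DualAlgebra k A →ₐ[k] W) (d : Dir) (f : DualAlgebra k A) :
    strandDual ι d f = writeLabel d (ι (twistLabel (dualAntipodeInv k A) d f)) := rfl

/-- For an upward strand this is the exchange relation at `γ(x)` and `(γ⁻¹)^*(f)`, read backwards:
`γ` swaps the factors of `Δ(x)`, `(γ⁻¹)^*` interchanges left and right translation, and right
multiplication reverses the products. -/
theorem exchange_strand {P : A →ₐ[k] W} {E : DualAlgebra k A →ₐ[k] W}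
    (h : Exchange P.toLinearMap E.toLinearMap) (d : Dir) :
    Exchange (strandAlg P d).toLinearMap (strandDual E d).toLinearMap := by
  intro x f
  refine LinearMap.ext fun w => ?_
  cases d
  · have := congrArg (· * w) (h x f)
    simp only [LinearMap.sum_apply, Finset.sum_mul, mul_assoc] at this ⊢
    exact this
  · have := congrArg (w * ·) (h.repr (antipodeRepr (ℛ k x)) (dualAntipodeInv k A f)).symm
    simp only [LinearMap.sum_apply, Finset.mul_sum, ← mul_assoc, antipodeRepr,
      ← dualAntipodeInv_frontHit, ← dualAntipodeInv_hitRight] at this ⊢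
    exact this

theorem DrinfeldDouble.antipode_ofAlg (x : A) :
    DrinfeldDouble.antipode k A (ofAlg k A x) = ofAlg k A (HopfAlgebra.antipode k x) := by
  change ofAlg k A (HopfAlgebra.antipode k x) * ofDual k A (dualAntipodeInv k A 1) = _
  rw [dualAntipodeInv_one, map_one, mul_one]

theorem DrinfeldDouble.antipode_ofDual (f : DualAlgebra k A) :
    DrinfeldDouble.antipode k A (ofDual k A f) = ofDual k A (dualAntipodeInv k A f) := by
  change ofAlg k A (HopfAlgebra.antipode k 1) * ofDual k A (dualAntipodeInv k A f) = _
  rw [antipode_one, map_one, one_mul]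

theorem HeisenbergDouble.mapDualAntipodeInv_ofDual (f : DualAlgebra k A) :
    mapDualAntipodeInv k A (ofDual k A f) = ofDual k A (dualAntipodeInv k A f) := rfl

variable [FiniteDimensional k A]

/-- One statement covers the labels of `J` and all four kinds of labels of `J'`. The hypotheses say
that the twists of labels restrict to `γ` on `A` and to `(γ⁻¹)^*` on `A^*`, so that the orientation
rule is absorbed into `strandAlg` and `strandDual`. -/
theorem writeCrossing_canonicalUnit {X Y : Type*} [Ring X] [Algebra k X] [Ring Y] [Algebra k Y]
    {ι₁ : X →ₐ[k] W} {ι₂ : Y →ₐ[k] W} {γ₁ : X →ₗ[k] X} {γ₂ : Y →ₗ[k] Y}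
    {P : A →ₐ[k] X} {E : DualAlgebra k A →ₐ[k] Y}
    (h₁ : ∀ x, γ₁ (P x) = P (antipode k x)) (h₂ : ∀ f, γ₂ (E f) = E (dualAntipodeInv k A f))
    (d₁ d₂ : Dir) (b : Bool) :
    writeCrossing ι₁ ι₂ γ₁ γ₂ d₁ d₂ (signed (canonicalUnit P E) b) =
      crossOp (strandAlg (ι₁.comp P) d₁).toLinearMap (strandDual (ι₂.comp E) d₂).toLinearMap b := by
  rw [signed_canonicalUnit, crossOp]
  have e₁ (x : A) : writeLabel (k := k) d₁ (ι₁ (twistLabel γ₁ d₁ (P x))) =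
      strandAlg (ι₁.comp P) d₁ x := by
    cases d₁ <;> simp [strandAlg_apply, twistLabel, h₁]
  have e₂ (f : DualAlgebra k A) : writeLabel (k := k) d₂ (ι₂ (twistLabel γ₂ d₂ (E f))) =
      strandDual (ι₂.comp E) d₂ f := by
    cases d₂ <;> simp [strandDual_apply, twistLabel, h₂]
  induction signed (universalUnit k A) b with
  | zero => simp [writeCrossing]
  | add s t hs ht =>
    simp only [map_add, ← hs, ← ht]
    simp only [writeCrossing, map_add]
  | tmul x f =>
    rw [evalPair_tmul, AlgHom.toLinearMap_apply, AlgHom.toLinearMap_apply, ← e₁, ← e₂]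
    rfl

end Strands

/-! ### Crossing operators for families of commuting strands. -/

section Family

variable {k A M σ : Type*} [Field k] [Ring A] [HopfAlgebra k A] [Ring M] [Algebra k M]

/-- Actions of `A` and `A^*` on strands, which commute for different strands. -/
structure CommutingStrands (α : σ → A →ₐ[k] M) (β : σ → DualAlgebra k A →ₐ[k] M) : Prop where
  alg_alg : ∀ i j, i ≠ j → ∀ x y, Commute (α i x) (α j y)
  alg_dual : ∀ i j, i ≠ j → ∀ x f, Commute (α i x) (β j f)
  dual_dual : ∀ i j, i ≠ j → ∀ f g, Commute (β i f) (β j g)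

variable [FiniteDimensional k A]

/-- The operator of a crossing with the given under and over strands. -/
def strandOp (α : σ → A →ₐ[k] M) (β : σ → DualAlgebra k A →ₐ[k] M) (b : Bool) (i j : σ) : M :=
  crossOp (α i).toLinearMap (β j).toLinearMap b

variable {α : σ → A →ₐ[k] M} {β : σ → DualAlgebra k A →ₐ[k] M}

namespace CommutingStrands

variable (h : CommutingStrands α β)
include h

theorem strandOp_mul_strandOp_not {i j : σ} (hij : i ≠ j) (b : Bool) :
    strandOp α β b i j * strandOp α β (!b) i j = 1 :=
  crossOp_mul_crossOp_not _ _ (h.alg_dual i j hij) b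

theorem commute_strandOp {i j i' j' : σ} (h₁ : i ≠ i') (h₂ : i ≠ j') (h₃ : j ≠ i') (h₄ : j ≠ j')
    (b b' : Bool) : Commute (strandOp α β b i j) (strandOp α β b' i' j') :=
  commute_crossOp (h.alg_alg _ _ h₁) (h.alg_dual _ _ h₂) (h.alg_dual _ _ h₃.symm)
    (h.dual_dual _ _ h₄) b b'

/-- Only the middle strand `q` is over at one crossing and under at another, so `Exchange` is
applied to `q` alone. -/
theorem strandOp_yangBaxter (hex : ∀ i, Exchange (α i).toLinearMap (β i).toLinearMap) {p q r : σ}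
    (hpq : p ≠ q) (hpr : p ≠ r) (hqr : q ≠ r) :
    strandOp α β true p q * (strandOp α β true p r * strandOp α β true q r) =
      strandOp α β true q r * (strandOp α β true p r * strandOp α β true p q) := by
  simp only [strandOp, crossOp_true]
  exact pairing_yangBaxter (α p) (α q) (β q) (β r) (h.alg_alg _ _ hpq) (h.alg_dual _ _ hpq)
    (h.alg_dual _ _ hpr) (h.alg_dual _ _ hqr) (h.dual_dual _ _ hqr) (hex q)

end CommutingStrands

end Family

/-! ### Local moves on a list of crossings. -/

section Reading

variable {W σ : Type*} {N : ℕ}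

/-- The under strand of a crossing. -/
def Crossing.underPos (c : Crossing N) : Fin N := if c.positive then c.left else c.right

/-- The over strand of a crossing. -/
def Crossing.overPos (c : Crossing N) : Fin N := if c.positive then c.right else c.left

theorem readCrossings_cons (act : Bool → σ → σ → W → W) (c : Crossing N) (l : List (Crossing N))
    (s : Fin N → σ) (w : W) :
    readCrossings act (c :: l) s w = readCrossings act l (s ∘ Equiv.swap c.left c.right)
      (act c.positive (s c.underPos) (s c.overPos) w) := by
  rw [readCrossings]
  rcases c with ⟨p, hp, _ | _⟩ <;> rfl

theorem Crossing.left_ne_right (c : Crossing N) : c.left ≠ c.right := by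
  simp [left, right, Fin.ext_iff]

theorem Crossing.underPos_ne_overPos (c : Crossing N) : c.underPos ≠ c.overPos := by
  rcases c with ⟨p, hp, _ | _⟩ <;> simp [underPos, overPos, left, right, Fin.ext_iff]

/-- The crossings above a local move permute the strands and change the element accumulated so far;
hence the local identity is required for every injective `s` and every `w`. -/
theorem readCrossings_append_congr (act : Bool → σ → σ → W → W) {l l' : List (Crossing N)}
    (h : ∀ s : Fin N → σ, s.Injective → ∀ w, readCrossings act l s w = readCrossings act l' s w)
    (u : List (Crossing N)) {s : Fin N → σ} (hs : s.Injective) (w : W) :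
    readCrossings act (u ++ l) s w = readCrossings act (u ++ l') s w := by
  induction u generalizing s w with
  | nil => exact h s hs w
  | cons c u ih =>
    rw [List.cons_append, List.cons_append, readCrossings_cons, readCrossings_cons]
    exact ih (hs.comp (Equiv.injective _)) _

variable {k A : Type*} [Field k] [Ring A] [HopfAlgebra k A] [FiniteDimensional k A] [Ring W]
  [Algebra k W]

variable {α : σ → A →ₐ[k] Module.End k W} {β : σ → DualAlgebra k A →ₐ[k] Module.End k W}

theorem readCrossings_cancel (h : CommutingStrands α β) (c : Crossing N) (v : List (Crossing N))
    {s : Fin N → σ} (hs : s.Injective) (w : W) :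
    readCrossings (fun b i j w => strandOp α β b i j w) (c :: c.flip :: v) s w =
      readCrossings (fun b i j w => strandOp α β b i j w) v s w := by
  rw [readCrossings_cons, readCrossings_cons]
  -- The two strands have changed places and the sign has changed too, so the same strand is under
  -- at both crossings.
  have h₁ : Equiv.swap c.left c.right c.flip.underPos = c.underPos := by
    rcases c with ⟨p, hp, _ | _⟩ <;> simp [Crossing.underPos, Crossing.flip, Crossing.left, Crossing.right]
  have h₂ : Equiv.swap c.left c.right c.flip.overPos = c.overPos := by
    rcases c with ⟨p, hp, _ | _⟩ <;> simp [Crossing.overPos, Crossing.flip, Crossing.left, Crossing.right]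
  congr 1
  · funext x
    exact congrArg s (Equiv.congr_fun (Equiv.swap_swap c.left c.right) x)
  · simp only [Function.comp_apply, h₁, h₂]
    rw [← Module.End.mul_apply]
    have := h.strandOp_mul_strandOp_not (hs.ne c.underPos_ne_overPos) (!c.positive)
    rw [Bool.not_not] at this
    exact LinearMap.congr_fun this w

theorem readCrossings_far (h : CommutingStrands α β) (c d : Crossing N) (hcd : c.pos + 1 < d.pos)
    (v : List (Crossing N)) {s : Fin N → σ} (hs : s.Injective) (w : W) :
    readCrossings (fun b i j w => strandOp α β b i j w) (c :: d :: v) s w =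
      readCrossings (fun b i j w => strandOp α β b i j w) (d :: c :: v) s w := by
  simp only [readCrossings_cons]
  have h₁ : c.left ≠ d.left := by simp [Crossing.left, Fin.ext_iff]; omega
  have h₂ : c.left ≠ d.right := by simp [Crossing.left, Crossing.right, Fin.ext_iff]; omega
  have h₃ : c.right ≠ d.left := by simp [Crossing.left, Crossing.right, Fin.ext_iff]; omega
  have h₄ : c.right ≠ d.right := by simp [Crossing.right, Fin.ext_iff]; omega
  have hne : (c.underPos ≠ d.underPos ∧ c.underPos ≠ d.overPos) ∧ (c.overPos ≠ d.underPos ∧ c.overPos ≠ d.overPos) := by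
    simp only [Crossing.underPos, Crossing.overPos]
    cases c.positive <;> cases d.positive <;> simp [h₁, h₂, h₃, h₄]
  have e₁ : Equiv.swap c.left c.right d.underPos = d.underPos :=
    Equiv.swap_apply_of_ne_of_ne
      (by unfold Crossing.underPos; split <;> simp [h₁.symm, h₂.symm])
      (by unfold Crossing.underPos; split <;> simp [h₃.symm, h₄.symm])
  have e₂ : Equiv.swap c.left c.right d.overPos = d.overPos :=
    Equiv.swap_apply_of_ne_of_ne
      (by unfold Crossing.overPos; split <;> simp [h₁.symm, h₂.symm])
      (by unfold Crossing.overPos; split <;> simp [h₃.symm, h₄.symm])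
  have e₃ : Equiv.swap d.left d.right c.underPos = c.underPos :=
    Equiv.swap_apply_of_ne_of_ne
      (by unfold Crossing.underPos; split <;> simp [h₁, h₃])
      (by unfold Crossing.underPos; split <;> simp [h₂, h₄])
  have e₄ : Equiv.swap d.left d.right c.overPos = c.overPos :=
    Equiv.swap_apply_of_ne_of_ne
      (by unfold Crossing.overPos; split <;> simp [h₁, h₃])
      (by unfold Crossing.overPos; split <;> simp [h₂, h₄])
  congr 1
  · have : Commute (Equiv.swap c.left c.right) (Equiv.swap d.left d.right) := by
      refine Equiv.Perm.Disjoint.commute ?_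
      refine Equiv.Perm.disjoint_swap_swap ?_
      simp [c.left_ne_right, d.left_ne_right, h₁, h₂, h₃, h₄]
    funext x
    exact congrArg s (Equiv.congr_fun this.eq x)
  · simp only [Function.comp_apply, e₁, e₂, e₃, e₄]
    exact LinearMap.congr_fun (h.commute_strandOp (hs.ne hne.1.1) (hs.ne hne.1.2) (hs.ne hne.2.1)
      (hs.ne hne.2.2) _ _).symm.eq w

theorem readCrossings_yangBaxter (h : CommutingStrands α β)
    (hex : ∀ i, Exchange (α i).toLinearMap (β i).toLinearMap) (i : ℕ) (h₁ : i + 1 < N)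
    (h₂ : i + 1 + 1 < N) (v : List (Crossing N)) {s : Fin N → σ} (hs : s.Injective) (w : W) :
    readCrossings (fun b i j w => strandOp α β b i j w)
        (⟨i, h₁, true⟩ :: ⟨i + 1, h₂, true⟩ :: ⟨i, h₁, true⟩ :: v) s w =
      readCrossings (fun b i j w => strandOp α β b i j w)
        (⟨i + 1, h₂, true⟩ :: ⟨i, h₁, true⟩ :: ⟨i + 1, h₂, true⟩ :: v) s w := by
  simp only [readCrossings_cons, Crossing.left, Crossing.right, Crossing.underPos, Crossing.overPos,
    if_true]
  set p : Fin N := ⟨i, Nat.lt_of_succ_lt h₁⟩ with hp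
  set q : Fin N := ⟨i + 1, h₁⟩ with hq
  set r : Fin N := ⟨i + 1 + 1, h₂⟩ with hr
  have hpq : p ≠ q := by simp [hp, hq]
  have hpr : p ≠ r := by simp [hp, hr]; omega
  have hqr : q ≠ r := by simp [hq, hr]
  congr 1
  -- Both products of three adjacent transpositions equal the transposition of the outer positions
  -- `p` and `r`.
  · have := (Equiv.swap_mul_swap_mul_swap hpq hpr).trans
      ((Equiv.swap_comm r p).trans (Equiv.swap_mul_swap_mul_swap hqr.symm hpr.symm).symm)
    rw [Equiv.swap_comm r q, Equiv.swap_comm q p] at this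
    funext x
    exact congrArg s (Equiv.congr_fun this.symm x)
  · have e₁ : Equiv.swap p q r = r := Equiv.swap_apply_of_ne_of_ne hpr.symm hqr.symm
    have e₂ : Equiv.swap q r p = p := Equiv.swap_apply_of_ne_of_ne hpq hpr
    simp only [Function.comp_apply, Equiv.swap_apply_left, Equiv.swap_apply_right, e₁, e₂]
    -- The operator of a lower crossing is composed on the left, so the diagrams correspond to the
    -- two sides of the equation in the opposite order.
    exact (LinearMap.congr_fun (h.strandOp_yangBaxter hex (hs.ne hpq) (hs.ne hpr) (hs.ne hqr)) w).symm

end Reading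

/-! ### Independence of `J` from the diagram. -/

section Invariance

variable {k A : Type*} [Field k] [Ring A] [HopfAlgebra k A] {n : ℕ}

theorem commute_singleAlgHom {ι : Type*} [DecidableEq ι] {X : ι → Type*} [∀ i, Ring (X i)]
    [∀ i, Algebra k (X i)] {i j : ι} (h : i ≠ j) (x : X i) (y : X j) :
    Commute (PiTensorProduct.singleAlgHom (R := k) (A := X) i x)
      (PiTensorProduct.singleAlgHom (R := k) (A := X) j y) :=
  Commute.tprod (Pi.mulSingle_commute h x y)

theorem Exchange.map {X Y : Type*} [Ring X] [Algebra k X] [Ring Y] [Algebra k Y] {P : A →ₐ[k] X}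
    {E : DualAlgebra k A →ₐ[k] X} (h : Exchange P.toLinearMap E.toLinearMap) (ι : X →ₐ[k] Y) :
    Exchange (ι.comp P).toLinearMap (ι.comp E).toLinearMap := fun x f => by
  have := congrArg ι (h x f)
  simp only [map_sum, map_mul] at this
  exact this

variable [InvertibleAntipode k A]

/-- The action of `A` on the strands by labels in `D(A)`. -/
def drinStrandAlg (d : Fin n → Dir) (i : Fin n) :
    A →ₐ[k] Module.End k (⨂[k] _ : Fin n, DrinfeldDouble k A) :=
  strandAlg ((strandEmb k A i).comp (DrinfeldDouble.ofAlg k A)) (d i)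

/-- The action of `A^*` on the strands by labels in `D(A)`. -/
def drinStrandDual (d : Fin n → Dir) (i : Fin n) :
    DualAlgebra k A →ₐ[k] Module.End k (⨂[k] _ : Fin n, DrinfeldDouble k A) :=
  strandDual ((strandEmb k A i).comp (DrinfeldDouble.ofDual k A)) (d i)

theorem commutingStrands_drin (d : Fin n → Dir) :
    CommutingStrands (drinStrandAlg (k := k) (A := A) d) (drinStrandDual d) where
  alg_alg _ _ h _ _ := writeLabel_commute (commute_singleAlgHom h _ _) _ _
  alg_dual _ _ h _ _ := writeLabel_commute (commute_singleAlgHom h _ _) _ _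
  dual_dual _ _ h _ _ := writeLabel_commute (commute_singleAlgHom h _ _) _ _

theorem exchange_drin (d : Fin n → Dir) (i : Fin n) :
    Exchange (drinStrandAlg (k := k) (A := A) d i).toLinearMap (drinStrandDual d i).toLinearMap :=
  exchange_strand (DrinfeldDouble.exchange.map (strandEmb k A i)) (d i)

variable [FiniteDimensional k A]

theorem BraidDiagram.J_eq (D : BraidDiagram n) :
    D.J k A = readCrossings
      (fun b i j w => strandOp (drinStrandAlg (k := k) (A := A) D.dir) (drinStrandDual D.dir) b i j w)
      D.crossings D.top 1 := by
  unfold BraidDiagram.J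
  congr 1
  funext b i j w
  exact LinearMap.congr_fun (writeCrossing_canonicalUnit DrinfeldDouble.antipode_ofAlg
    DrinfeldDouble.antipode_ofDual (D.dir i) (D.dir j) b) w

theorem BraidDiagram.J_eq_of_move {D D' : BraidDiagram n} (h : D.Move D') : D.J k A = D'.J k A := by
  simp only [BraidDiagram.J_eq]
  cases h with
  | cancel u v c top dir =>
    exact readCrossings_append_congr _
      (fun s hs w => readCrossings_cancel (commutingStrands_drin (k := k) (A := A) dir) c v hs w) u top.injective 1
  | yangBaxter u v i h₁ h₂ top dir =>
    exact readCrossings_append_congr _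
      (fun s hs w => readCrossings_yangBaxter (commutingStrands_drin (k := k) (A := A) dir) (exchange_drin dir)
        i h₁ h₂ v hs w) u top.injective 1
  | far u v c d h top dir =>
    exact readCrossings_append_congr _
      (fun s hs w => readCrossings_far (commutingStrands_drin (k := k) (A := A) dir) c d h v hs w) u top.injective 1

/-- The universal invariant does not depend on the diagram. -/
theorem BraidDiagram.J_eq_of_isDiagramOf {D : BraidDiagram n} {T : Braid n} (h : D.IsDiagramOf T) :
    D.J k A = T.J k A :=
  congrArg (Quot.lift (fun D : BraidDiagram n => D.J k A) fun _ _ => J_eq_of_move)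
    (h.trans T.diagram_isDiagramOf.symm)

end Invariance

/-! ### Combinatorics of duplicated crossings. -/

section Duplication

variable {n : ℕ}

/-- The thickness of the left copy of a strand. -/
def leftCopy : Dir → Thickness
  | .down => .thin
  | .up => .thick

/-- The thickness of the right copy of a strand. -/
def rightCopy : Dir → Thickness
  | .down => .thick
  | .up => .thin

theorem leftCopy_ne_rightCopy (d : Dir) : leftCopy d ≠ rightCopy d := by
  cases d <;> simp [leftCopy, rightCopy]

/-- The duplicated strands, in their order from left to right. -/
def duplicateStrands (d : Fin n → Dir) (s : Fin n → Fin n) (p : Fin (2 * n)) : Fin n × Thickness :=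
  (s ⟨p / 2, by have := p.2; omega⟩,
    if (p : ℕ) % 2 = 0 then leftCopy (d (s ⟨p / 2, by have := p.2; omega⟩))
    else rightCopy (d (s ⟨p / 2, by have := p.2; omega⟩)))

theorem BraidDiagram.duplicateTop_eq (D : BraidDiagram n) :
    D.duplicateTop = duplicateStrands D.dir D.top := by
  funext p
  unfold BraidDiagram.duplicateTop duplicateStrands
  dsimp only
  congr 1
  by_cases h : (p : ℕ) % 2 = 0 <;>
    cases D.dir (D.top ⟨p / 2, by have := p.2; omega⟩) <;> simp [h, leftCopy, rightCopy]

/-- The four crossings of the duplicate of a crossing with the given left and right strands. -/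
def quadruple {W : Type*} (act : Bool → Fin n × Thickness → Fin n × Thickness → W → W)
    (d : Fin n → Dir) (i j : Fin n) (w : W) : Bool → W
  | true => act true (i, leftCopy (d i)) (j, rightCopy (d j))
      (act true (i, rightCopy (d i)) (j, rightCopy (d j))
        (act true (i, leftCopy (d i)) (j, leftCopy (d j))
          (act true (i, rightCopy (d i)) (j, leftCopy (d j)) w)))
  | false => act false (j, rightCopy (d j)) (i, leftCopy (d i))
      (act false (j, rightCopy (d j)) (i, rightCopy (d i))
        (act false (j, leftCopy (d j)) (i, leftCopy (d i))
          (act false (j, leftCopy (d j)) (i, rightCopy (d i)) w)))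

theorem duplicateStrands_even (d : Fin n → Dir) (s : Fin n → Fin n) (p : Fin n) {q : Fin (2 * n)}
    (h : (q : ℕ) = 2 * p) : duplicateStrands d s q = (s p, leftCopy (d (s p))) := by
  have : (⟨(q : ℕ) / 2, by have := q.2; omega⟩ : Fin n) = p := Fin.ext (by simp [h])
  simp only [duplicateStrands, this]
  rw [if_pos (by omega)]

theorem duplicateStrands_odd (d : Fin n → Dir) (s : Fin n → Fin n) (p : Fin n) {q : Fin (2 * n)}
    (h : (q : ℕ) = 2 * p + 1) : duplicateStrands d s q = (s p, rightCopy (d (s p))) := by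
  have : (⟨(q : ℕ) / 2, by have := q.2; omega⟩ : Fin n) = p := Fin.ext (by simp [h]; omega)
  simp only [duplicateStrands, this]
  rw [if_neg (by omega)]

/-- The two inner copies meet first and the two outer copies last, with one crossing on each side in
between; following the positions gives the nesting in `quadruple`. Afterwards the strands are again
the duplicates of an arrangement of single strands, so an induction on crossings can continue. -/
theorem readCrossings_duplicate {W : Type*}
    (act : Bool → Fin n × Thickness → Fin n × Thickness → W → W) (d : Fin n → Dir) (c : Crossing n)
    (l : List (Crossing (2 * n))) (s : Fin n → Fin n) (w : W) :
    readCrossings act (c.duplicate ++ l) (duplicateStrands d s) w =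
      readCrossings act l (duplicateStrands d (s ∘ Equiv.swap c.left c.right))
        (quadruple act d (s c.left) (s c.right) w c.positive) := by
  have hc := c.lt
  set p₀ : Fin (2 * n) := ⟨2 * c.pos, by omega⟩ with hp₀
  set p₁ : Fin (2 * n) := ⟨2 * c.pos + 1, by omega⟩ with hp₁
  set p₂ : Fin (2 * n) := ⟨2 * c.pos + 2, by omega⟩ with hp₂
  set p₃ : Fin (2 * n) := ⟨2 * c.pos + 3, by omega⟩ with hp₃
  have h₀₁ : p₀ ≠ p₁ := by simp [hp₀, hp₁]
  have h₀₂ : p₀ ≠ p₂ := by simp [hp₀, hp₂]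
  have h₀₃ : p₀ ≠ p₃ := by simp [hp₀, hp₃]
  have h₁₂ : p₁ ≠ p₂ := by simp [hp₁, hp₂]
  have h₁₃ : p₁ ≠ p₃ := by simp [hp₁, hp₃]
  have h₂₃ : p₂ ≠ p₃ := by simp [hp₂, hp₃]
  have e₀ (s) := duplicateStrands_even d s c.left (q := p₀) rfl
  have e₁ (s) := duplicateStrands_odd d s c.left (q := p₁) rfl
  have e₂ (s) := duplicateStrands_even d s c.right (q := p₂) rfl
  have e₃ (s) := duplicateStrands_odd d s c.right (q := p₃) rfl
  -- Together the four transpositions exchange the blocks `(p₀, p₁)` and `(p₂, p₃)` and keep the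
  -- order within each block.
  have hs : (((duplicateStrands d s ∘ Equiv.swap p₁ p₂) ∘ Equiv.swap p₀ p₁) ∘ Equiv.swap p₂ p₃) ∘
      Equiv.swap p₁ p₂ = duplicateStrands d (s ∘ Equiv.swap c.left c.right) := by
    funext q
    simp only [Function.comp_apply]
    by_cases q₀ : q = p₀
    · subst q₀
      simp [e₀, e₂, Equiv.swap_apply_of_ne_of_ne, h₀₁, h₀₂, h₀₃]
    by_cases q₁ : q = p₁
    · subst q₁
      simp [e₁, e₃, Equiv.swap_apply_of_ne_of_ne, h₀₃.symm, h₁₃.symm, h₂₃.symm]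
    by_cases q₂ : q = p₂
    · subst q₂
      simp [e₀, e₂, Equiv.swap_apply_of_ne_of_ne, h₁₂, h₁₃, h₀₁, h₀₂]
    by_cases q₃ : q = p₃
    · subst q₃
      simp [e₁, e₃, Equiv.swap_apply_of_ne_of_ne, h₁₃.symm, h₂₃.symm, h₀₂.symm, h₁₂.symm]
    rw [Equiv.swap_apply_of_ne_of_ne q₁ q₂, Equiv.swap_apply_of_ne_of_ne q₂ q₃,
      Equiv.swap_apply_of_ne_of_ne q₀ q₁, Equiv.swap_apply_of_ne_of_ne q₁ q₂]
    have hq : Equiv.swap c.left c.right ⟨(q : ℕ) / 2, by have := q.2; omega⟩ =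
        ⟨(q : ℕ) / 2, by have := q.2; omega⟩ := by
      simp only [hp₀, hp₁, hp₂, hp₃, Fin.ext_iff] at q₀ q₁ q₂ q₃
      apply Equiv.swap_apply_of_ne_of_ne <;>
        simp only [Crossing.left, Crossing.right, ne_eq, Fin.ext_iff] <;> omega
    simp only [duplicateStrands, Function.comp_apply, hq]
  rw [← hs]
  rcases c with ⟨p, hp, _ | _⟩
  all_goals
    refine congrArg (readCrossings act l _) ?_
    set t := duplicateStrands d s
    set t₁ := t ∘ Equiv.swap p₁ p₂ with ht₁
    set t₂ := t₁ ∘ Equiv.swap p₀ p₁ with ht₂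
    set t₃ := t₂ ∘ Equiv.swap p₂ p₃ with ht₃
    have f₁ : t₁ p₀ = t p₀ ∧ t₁ p₁ = t p₂ ∧ t₂ p₂ = t p₁ ∧ t₂ p₃ = t p₃ ∧ t₃ p₁ = t p₀ ∧
        t₃ p₂ = t p₃ := by
      simp [ht₁, ht₂, ht₃, Equiv.swap_apply_of_ne_of_ne, h₀₁, h₀₂, h₁₂, h₁₃, h₀₂.symm,
        h₀₃.symm, h₁₂.symm, h₁₃.symm, h₂₃.symm]
    obtain ⟨f₁, f₂, f₃, f₄, f₅, f₆⟩ := f₁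
    have g₀ : t p₀ = _ := e₀ s
    have g₁ : t p₁ = _ := e₁ s
    have g₂ : t p₂ = _ := e₂ s
    have g₃ : t p₃ = _ := e₃ s
  · change act false (t₃ p₂) (t₃ p₁) (act false (t₂ p₃) (t₂ p₂) (act false (t₁ p₁) (t₁ p₀)
      (act false (t p₂) (t p₁) w))) = _
    rw [f₁, f₂, f₃, f₄, f₅, f₆, g₀, g₁, g₂, g₃]
    rfl
  · change act true (t₃ p₁) (t₃ p₂) (act true (t₂ p₂) (t₂ p₃) (act true (t₁ p₀) (t₁ p₁)
      (act true (t p₁) (t p₂) w))) = _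
    rw [f₁, f₂, f₃, f₄, f₅, f₆, g₀, g₁, g₂, g₃]
    rfl

end Duplication

/-! ### Splitting a crossing into four by the coproducts of `A` and `A^*`. -/

section FourCrossings

variable {k A M : Type*} [Field k] [Ring A] [HopfAlgebra k A] [FiniteDimensional k A] [Ring M]
  [Algebra k M]

/-- The pairing of products of actions is a product of four pairings. -/
theorem pairing_eq_four {α₁ α₂ Q : A →ₐ[k] M} {β₁ β₂ B : DualAlgebra k A →ₐ[k] M}
    (hQ : ∀ x, Q x = (toConv α₁.toLinearMap * toConv α₂.toLinearMap).ofConv x)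
    (hB : ∀ f, B f = LinearMap.mul' k M
      (TensorProduct.map β₂.toLinearMap β₁.toLinearMap (comulDual k A f)))
    (h₁₂ : ∀ x f, Commute (α₁ x) (β₂ f))
    (h₂₁ : ∀ x f, Commute (α₂ x) (β₁ f)) (h₂₂ : ∀ x f, Commute (α₂ x) (β₂ f)) :
    pairing Q.toLinearMap B.toLinearMap =
      pairing α₁.toLinearMap β₂.toLinearMap * (pairing α₂.toLinearMap β₂.toLinearMap *
        (pairing α₁.toLinearMap β₁.toLinearMap * pairing α₂.toLinearMap β₁.toLinearMap)) := by
  have hQ' : (toConv α₁.toLinearMap * toConv α₂.toLinearMap).ofConv = Q.toLinearMap :=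
    LinearMap.ext fun x => (hQ x).symm
  -- Grouping the four factors by their over strand turns the right side into `pairing Q β₂ *
  -- pairing Q β₁`; what is left is the splitting `(1 ⊗ Δ)(R)` of the second tensorand.
  rw [pairing_mul_pairing _ _ β₁ h₂₁, ← mul_assoc, pairing_mul_pairing _ _ β₂ h₂₂, hQ']
  have hc (x f) : Commute (Q x) (β₂ f) := by
    rw [hQ, show (toConv α₁.toLinearMap * toConv α₂.toLinearMap).ofConv x = _ from
      (ℛ k x).convMul_apply _ _]
    exact Commute.sum_left _ _ _ fun i _ => (h₁₂ _ _).mul_left (h₂₂ _ _)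
  set e := Module.finBasis k A with he
  have hB' (f) : B f = ∑ i, β₂ (hitRight k A (e i) f) * β₁ (toConv (e.coord i)) := by
    simp [hB, comulDual_apply, he]
  -- Expanding `Δ(e^l)` produces `e^l(? e_i)`; the transpose moves this translation to `Q(e_l e_i) =
  -- Q(e_l) Q(e_i)`, and `hc` then lets `Q(e_i)` pass `β₂`.
  have hr (i) : ∑ l, Q (e l) * β₂ (hitRight k A (e i) (toConv (e.coord l))) =
      ∑ l, Q (e l) * Q (e i) * β₂ (toConv (e.coord l)) := by
    have := (pairing_transpose Q.toLinearMap β₂.toLinearMap (LinearMap.mulRight k (e i))).symm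
    simpa [pairing, ← he, dualTranspose_mulRight] using this
  calc pairing Q.toLinearMap B.toLinearMap
      = ∑ l, ∑ i, Q (e l) * β₂ (hitRight k A (e i) (toConv (e.coord l))) *
          β₁ (toConv (e.coord i)) := by
        simp only [pairing, ← he, AlgHom.toLinearMap_apply, hB', Finset.mul_sum, mul_assoc]
    _ = ∑ i, ∑ l, Q (e l) * Q (e i) * β₂ (toConv (e.coord l)) * β₁ (toConv (e.coord i)) := by
        rw [Finset.sum_comm]
        simp only [← Finset.sum_mul, hr]
    _ = _ := by
        rw [Finset.sum_comm]
        simp only [pairing, ← he, AlgHom.toLinearMap_apply, Finset.sum_mul_sum]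
        refine Finset.sum_congr rfl fun l _ => Finset.sum_congr rfl fun i _ => ?_
        rw [mul_assoc (Q _) (Q _), (hc _ _).eq]
        simp only [mul_assoc]

end FourCrossings

/-! ### Intertwiners of crossing operators. -/

section MapPair

variable {k A : Type*} [Field k] [Ring A] [HopfAlgebra k A]

theorem map_evalPair {V W : Type*} [AddCommGroup V] [Module k V] [AddCommGroup W] [Module k W]
    (Φ : V →ₗ[k] W) {α : A →ₗ[k] Module.End k V} {α' : A →ₗ[k] Module.End k W}
    {β : DualAlgebra k A →ₗ[k] Module.End k V} {β' : DualAlgebra k A →ₗ[k] Module.End k W}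
    (hα : ∀ x v, Φ (α x v) = α' x (Φ v)) (hβ : ∀ f v, Φ (β f v) = β' f (Φ v))
    (t : A ⊗[k] DualAlgebra k A) (v : V) : Φ (evalPair α β t v) = evalPair α' β' t (Φ v) := by
  induction t with
  | zero => simp
  | tmul x f => simp [hα, hβ]
  | add s t hs ht => simp [hs, ht]

end MapPair

/-! ### The actions through `φ` in terms of the thin and thick copies. -/

section Copies

variable {k A W : Type*} [Field k] [Ring A] [HopfAlgebra k A] [Ring W] [Algebra k W] {n : ℕ}

/-- Labels of the thin copies, given algebra homomorphisms for the pairs of copies. -/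
def thinLabel (ι : Fin n → HeisenbergDouble k A ⊗[k] (HeisenbergDouble k A)ᵐᵒᵖ →ₐ[k] W)
    (i : Fin n) : HeisenbergDouble k A →ₐ[k] W :=
  (ι i).comp Algebra.TensorProduct.includeLeft

/-- Labels of the thick copies, given algebra homomorphisms for the pairs of copies. -/
def thickLabel (ι : Fin n → HeisenbergDouble k A ⊗[k] (HeisenbergDouble k A)ᵐᵒᵖ →ₐ[k] W)
    (i : Fin n) : (HeisenbergDouble k A)ᵐᵒᵖ →ₐ[k] W :=
  (ι i).comp Algebra.TensorProduct.includeRight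

variable {ι : Fin n → HeisenbergDouble k A ⊗[k] (HeisenbergDouble k A)ᵐᵒᵖ →ₐ[k] W}

theorem label_tmul (i : Fin n) (x : HeisenbergDouble k A) (y : (HeisenbergDouble k A)ᵐᵒᵖ) :
    ι i (x ⊗ₜ y) = thinLabel ι i x * thickLabel ι i y := by
  have : x ⊗ₜ[k] y = (x ⊗ₜ 1) * (1 ⊗ₜ y) := by simp
  rw [this, map_mul]
  rfl

theorem thinLabel_commute_thickLabel_self (i : Fin n) (x : HeisenbergDouble k A)
    (y : (HeisenbergDouble k A)ᵐᵒᵖ) : Commute (thinLabel ι i x) (thickLabel ι i y) := by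
  refine Commute.map (f := ι i) ?_
  simp [Commute, SemiconjBy]

theorem thinLabel_commute_thickLabel (hι : ∀ i j, i ≠ j → ∀ x y, Commute (ι i x) (ι j y))
    (i j : Fin n) (x : HeisenbergDouble k A) (y : (HeisenbergDouble k A)ᵐᵒᵖ) :
    Commute (thinLabel ι i x) (thickLabel ι j y) := by
  rcases eq_or_ne i j with rfl | h
  · exact thinLabel_commute_thickLabel_self i x y
  · exact hι _ _ h _ _

variable (ι)

/-- The action of `A` on the duplicated strands. -/
def copyAlg (d : Fin n → Dir) : Fin n × Thickness → A →ₐ[k] Module.End k W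
  | (i, .thin) => strandAlg ((thinLabel ι i).comp (HeisenbergDouble.ofAlg k A)) (d i)
  | (i, .thick) => strandAlg ((thickLabel ι i).comp (twistedAlg k A)) (d i)

/-- The action of `A` on the pairs of copies through `φ`. -/
def pairAlg (d : Fin n → Dir) (i : Fin n) : A →ₐ[k] Module.End k W :=
  strandAlg ((ι i).comp (phiAlg k A)) (d i)

variable {ι}

/-- The left copy receives `x'` and the right copy `x''` for both orientations. On an upward strand
`γ` swaps the factors of `Δ(x)`, which is compensated by the thick copy standing on the left there.
-/
theorem pairAlg_apply (d : Fin n → Dir) (i : Fin n) (x : A) :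
    pairAlg ι d i x = (toConv (copyAlg ι d (i, leftCopy (d i))).toLinearMap *
      toConv (copyAlg ι d (i, rightCopy (d i))).toLinearMap).ofConv x := by
  refine Eq.trans ?_ ((ℛ k x).convMul_apply _ _).symm
  rw [pairAlg, strandAlg_apply]
  refine LinearMap.ext fun w => ?_
  rw [LinearMap.sum_apply]
  cases hd : d i
  · simp only [twistLabel, LinearMap.id_apply, AlgHom.comp_apply, phiAlg_apply x (ℛ k x), map_sum,
      LinearMap.sum_apply, label_tmul]
    refine Finset.sum_congr rfl fun j _ => ?_
    simp [copyAlg, leftCopy, rightCopy, strandAlg_apply, hd, twistLabel, mul_assoc]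
    rfl
  · simp only [twistLabel, AlgHom.comp_apply, phiAlg_apply _ (antipodeRepr (ℛ k x)), map_sum,
      LinearMap.sum_apply, label_tmul]
    refine Finset.sum_congr rfl fun j _ => ?_
    simp [copyAlg, leftCopy, rightCopy, strandAlg_apply, hd, twistLabel, antipodeRepr,
      ← mul_assoc]
    rfl

variable [InvertibleAntipode k A] (ι)

/-- The action of `A^*` on the duplicated strands. -/
def copyDual (d : Fin n → Dir) : Fin n × Thickness → DualAlgebra k A →ₐ[k] Module.End k W
  | (i, .thin) => strandDual ((thinLabel ι i).comp (HeisenbergDouble.ofDual k A)) (d i)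
  | (i, .thick) => strandDual ((thickLabel ι i).comp (twistedDual k A)) (d i)

variable {ι}

/-- Copies of different components commute by `hι`; the two copies of one component commute because
they label different factors of `H(A) ⊗ H(A)^op`. -/
theorem commutingStrands_copy (hι : ∀ i j, i ≠ j → ∀ x y, Commute (ι i x) (ι j y))
    (d : Fin n → Dir) : CommutingStrands (copyAlg ι d) (copyDual ι d) where
  alg_alg := by
    rintro ⟨i, _ | _⟩ ⟨j, _ | _⟩ h x y <;> refine writeLabel_commute ?_ _ _
    · exact hι _ _ (fun e => h (by rw [e])) _ _
    · exact thinLabel_commute_thickLabel hι _ _ _ _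
    · exact (thinLabel_commute_thickLabel hι _ _ _ _).symm
    · exact hι _ _ (fun e => h (by rw [e])) _ _
  alg_dual := by
    rintro ⟨i, _ | _⟩ ⟨j, _ | _⟩ h x y <;> refine writeLabel_commute ?_ _ _
    · exact hι _ _ (fun e => h (by rw [e])) _ _
    · exact thinLabel_commute_thickLabel hι _ _ _ _
    · exact (thinLabel_commute_thickLabel hι _ _ _ _).symm
    · exact hι _ _ (fun e => h (by rw [e])) _ _
  dual_dual := by
    rintro ⟨i, _ | _⟩ ⟨j, _ | _⟩ h x y <;> refine writeLabel_commute ?_ _ _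
    · exact hι _ _ (fun e => h (by rw [e])) _ _
    · exact thinLabel_commute_thickLabel hι _ _ _ _
    · exact (thinLabel_commute_thickLabel hι _ _ _ _).symm
    · exact hι _ _ (fun e => h (by rw [e])) _ _

variable [FiniteDimensional k A] (ι)

/-- Write the label of a crossing of the duplicated diagram. -/
def writeCopies (d : Fin n → Dir) (b : Bool) :
    Fin n × Thickness → Fin n × Thickness → W →ₗ[k] W
  | (i, .thin), (j, .thin) =>
    writeCrossing (thinLabel ι i) (thinLabel ι j) (HeisenbergDouble.mapAntipode k A)
      (HeisenbergDouble.mapDualAntipodeInv k A) (d i) (d j) (signed (HeisenbergDouble.S k A) b)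
  | (i, .thick), (j, .thin) =>
    writeCrossing (thickLabel ι i) (thinLabel ι j)
      ((MulOpposite.opLinearEquiv k).conj (HeisenbergDouble.mapAntipode k A))
      (HeisenbergDouble.mapDualAntipodeInv k A) (d i) (d j) (signed (HeisenbergDouble.S' k A) b)
  | (i, .thin), (j, .thick) =>
    writeCrossing (thinLabel ι i) (thickLabel ι j) (HeisenbergDouble.mapAntipode k A)
      ((MulOpposite.opLinearEquiv k).conj (HeisenbergDouble.mapDualAntipodeInv k A)) (d i) (d j)
      (signed (HeisenbergDouble.S'' k A) b)
  | (i, .thick), (j, .thick) =>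
    writeCrossing (thickLabel ι i) (thickLabel ι j)
      ((MulOpposite.opLinearEquiv k).conj (HeisenbergDouble.mapAntipode k A))
      ((MulOpposite.opLinearEquiv k).conj (HeisenbergDouble.mapDualAntipodeInv k A)) (d i) (d j)
      (signed (HeisenbergDouble.STilde k A) b)

theorem writeCopies_eq (d : Fin n → Dir) (b : Bool) (x y : Fin n × Thickness) :
    writeCopies ι d b x y = strandOp (copyAlg ι d) (copyDual ι d) b x y := by
  have h₁ (a : A) : (MulOpposite.opLinearEquiv k).conj (HeisenbergDouble.mapAntipode k A)
      (twistedAlg k A a) = twistedAlg k A (antipode k a) := rfl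
  have h₂ (f : DualAlgebra k A) :
      (MulOpposite.opLinearEquiv k).conj (HeisenbergDouble.mapDualAntipodeInv k A)
        (twistedDual k A f) = twistedDual k A (dualAntipodeInv k A f) := rfl
  rcases x with ⟨i, _ | _⟩ <;> rcases y with ⟨j, _ | _⟩
  · exact writeCrossing_canonicalUnit HeisenbergDouble.mapAntipode_ofAlg
      HeisenbergDouble.mapDualAntipodeInv_ofDual (d i) (d j) b
  · exact writeCrossing_canonicalUnit HeisenbergDouble.mapAntipode_ofAlg h₂ (d i) (d j) b
  · exact writeCrossing_canonicalUnit h₁ HeisenbergDouble.mapDualAntipodeInv_ofDual (d i) (d j) b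
  · exact writeCrossing_canonicalUnit h₁ h₂ (d i) (d j) b

/-- The action of `A^*` on the pairs of copies through `φ`. -/
def pairDual (d : Fin n → Dir) (i : Fin n) : DualAlgebra k A →ₐ[k] Module.End k W :=
  strandDual ((ι i).comp (phiDual k A)) (d i)

variable {ι}

theorem commutingStrands_pair (hι : ∀ i j, i ≠ j → ∀ x y, Commute (ι i x) (ι j y))
    (d : Fin n → Dir) : CommutingStrands (pairAlg ι d) (pairDual ι d) where
  alg_alg _ _ h _ _ := writeLabel_commute (hι _ _ h _ _) _ _
  alg_dual _ _ h _ _ := writeLabel_commute (hι _ _ h _ _) _ _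
  dual_dual _ _ h _ _ := writeLabel_commute (hι _ _ h _ _) _ _

/-- Because `φ` flips `Δ(f)`, the right copy receives `f'` and the left copy `f''`, in the opposite
order to `pairAlg_apply`. For upward strands the flip by `(γ⁻¹)^*` is again compensated by the
exchanged positions of the copies. -/
theorem pairDual_apply (d : Fin n → Dir) (i : Fin n) (f : DualAlgebra k A) :
    pairDual ι d i f = LinearMap.mul' k _ (TensorProduct.map
      (copyDual ι d (i, rightCopy (d i))).toLinearMap
      (copyDual ι d (i, leftCopy (d i))).toLinearMap (comulDual k A f)) := by
  rw [pairDual, strandDual_apply]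
  cases hd : d i
  · simp only [twistLabel, LinearMap.id_apply, AlgHom.comp_apply, phiDual_apply]
    induction comulDual k A f with
    | zero => simp
    | add s t hs ht => simp only [map_add, hs, ht]
    | tmul p q =>
      simp only [TensorProduct.comm_tmul, TensorProduct.map_tmul, AlgHom.toLinearMap_apply,
        label_tmul, (thinLabel_commute_thickLabel_self i _ _).eq]
      refine LinearMap.ext fun w => ?_
      simp [copyDual, leftCopy, rightCopy, strandDual_apply, hd, twistLabel, mul_assoc]
  · simp only [twistLabel, AlgHom.comp_apply, phiDual_apply, comulDual_dualAntipodeInv]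
    induction comulDual k A f with
    | zero => simp
    | add s t hs ht => simp only [map_add, hs, ht]
    | tmul p q =>
      simp only [TensorProduct.comm_tmul, TensorProduct.map_tmul, AlgHom.toLinearMap_apply,
        label_tmul, (thinLabel_commute_thickLabel_self i _ _).eq]
      refine LinearMap.ext fun w => ?_
      simp [copyDual, leftCopy, rightCopy, strandDual_apply, hd, twistLabel, ← mul_assoc]

theorem strandOp_pair_true (hι : ∀ i j, i ≠ j → ∀ x y, Commute (ι i x) (ι j y))
    (d : Fin n → Dir) {i j : Fin n} (h : i ≠ j)
    (w : W) :
    strandOp (pairAlg ι d) (pairDual ι d) true i j w =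
      quadruple (fun b x y w => strandOp (copyAlg ι d) (copyDual ι d) b x y w)
        d i j w true := by
  have hc := commutingStrands_copy hι d
  have hne (s t : Thickness) : (i, s) ≠ (j, t) := fun e => h (congrArg Prod.fst e)
  simp only [strandOp, crossOp_true, quadruple]
  exact LinearMap.congr_fun (pairing_eq_four (pairAlg_apply d i) (pairDual_apply d j)
    (hc.alg_dual _ _ (hne _ _)) (hc.alg_dual _ _ (hne _ _)) (hc.alg_dual _ _ (hne _ _))) w

/-- The under strand is now the right one, `j`. The operator is inverse to the positive one with
under strand `j` and over strand `i`, so `strandOp_pair_true` is used with `i` and `j` exchanged,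
and its four factors are cancelled one by one. -/
theorem strandOp_pair_false (hι : ∀ i j, i ≠ j → ∀ x y, Commute (ι i x) (ι j y))
    (d : Fin n → Dir) {i j : Fin n} (h : i ≠ j)
    (w : W) :
    strandOp (pairAlg ι d) (pairDual ι d) false j i w =
      quadruple (fun b x y w => strandOp (copyAlg ι d) (copyDual ι d) b x y w)
        d i j w false := by
  have hc := commutingStrands_copy hι d
  have hne (s t : Thickness) : (j, s) ≠ (i, t) := fun e => h (congrArg Prod.fst e).symm
  have hinv (s t : Thickness)
      (w : W) :
      strandOp (copyAlg ι d) (copyDual ι d) false (j, s) (i, t)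
        (strandOp (copyAlg ι d) (copyDual ι d) true (j, s) (i, t) w) = w :=
    LinearMap.congr_fun (hc.strandOp_mul_strandOp_not (hne s t) false) w
  obtain ⟨v, rfl⟩ : ∃ v, strandOp (pairAlg ι d) (pairDual ι d) true j i v = w :=
    ⟨_, LinearMap.congr_fun
      ((commutingStrands_pair hι d).strandOp_mul_strandOp_not h.symm true) w⟩
  have h₁ : strandOp (pairAlg ι d) (pairDual ι d) false j i
      (strandOp (pairAlg ι d) (pairDual ι d) true j i v) = v :=
    LinearMap.congr_fun ((commutingStrands_pair hι d).strandOp_mul_strandOp_not h.symm false) v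
  -- Inverting reverses the four factors, which leaves the middle two in the order opposite to that
  -- of `quadruple`; they involve disjoint copies and commute.
  have h₂ (w) := LinearMap.congr_fun (hc.commute_strandOp (i := (j, rightCopy (d j)))
    (j := (i, rightCopy (d i))) (i' := (j, leftCopy (d j))) (j' := (i, leftCopy (d i)))
    (fun e => leftCopy_ne_rightCopy _ (congrArg Prod.snd e).symm) (hne _ _) (hne _ _).symm
    (fun e => leftCopy_ne_rightCopy _ (congrArg Prod.snd e).symm) true true).eq w
  simp only [Module.End.mul_apply] at h₂
  rw [h₁, strandOp_pair_true hι d h.symm]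
  simp only [quadruple, h₂, hinv]

end Copies

/-! ### Tensor powers of algebra homomorphisms. -/

section TensorPower

variable {k : Type*} [Field k] {n : ℕ}

/-- The tensor power of an algebra homomorphism. -/
def tensorPower {X Y : Type*} [Ring X] [Algebra k X] [Ring Y] [Algebra k Y] (f : X →ₐ[k] Y)
    (n : ℕ) : (⨂[k] _ : Fin n, X) →ₐ[k] ⨂[k] _ : Fin n, Y :=
  AlgHom.ofLinearMap (PiTensorProduct.map (fun _ : Fin n => f.toLinearMap))
    (by
      rw [PiTensorProduct.one_def, PiTensorProduct.map_tprod, PiTensorProduct.one_def]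
      congr 1
      funext i
      exact map_one f)
    (LinearMap.map_mul_iff _ |>.mpr <| by
      ext x y
      simp [PiTensorProduct.map_tprod]
      rfl)

theorem tensorPower_singleAlgHom {X Y : Type*} [Ring X] [Algebra k X] [Ring Y] [Algebra k Y]
    (f : X →ₐ[k] Y) (i : Fin n) (x : X) :
    tensorPower f n (PiTensorProduct.singleAlgHom (R := k) (A := fun _ : Fin n => X) i x) =
      PiTensorProduct.singleAlgHom (R := k) (A := fun _ : Fin n => Y) i (f x) := by
  refine (PiTensorProduct.map_tprod _ _).trans (congrArg (PiTensorProduct.tprod k) ?_)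
  funext j
  exact Pi.apply_mulSingle (fun _ => f) (fun _ => map_one f) i x j

end TensorPower

/-! ### Transporting `J` along `φ^{⊗ n}`. -/

section Main

variable {k A W : Type*} [Field k] [Ring A] [HopfAlgebra k A] [InvertibleAntipode k A]
  [FiniteDimensional k A] [Ring W] [Algebra k W] {n : ℕ}
  {ι : Fin n → HeisenbergDouble k A ⊗[k] (HeisenbergDouble k A)ᵐᵒᵖ →ₐ[k] W}
  {Φ : (⨂[k] _ : Fin n, DrinfeldDouble k A) →ₐ[k] W}

/-- `Φ` respects left and right multiplication, and the orientation twist is made inside `A` and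
`A^*` before `φ` is applied; so no antipode on the target of `φ` is needed. -/
theorem map_strandOp (hΦ : ∀ i x, Φ (strandEmb k A i x) = ι i (phi k A x)) (d : Fin n → Dir)
    (b : Bool) (i j : Fin n) (w : ⨂[k] _ : Fin n, DrinfeldDouble k A) :
    Φ (strandOp (drinStrandAlg d) (drinStrandDual d) b i j w) =
      strandOp (pairAlg ι d) (pairDual ι d) b i j (Φ w) := by
  refine map_evalPair Φ.toLinearMap (fun x v => ?_) (fun f v => ?_) _ w
  · simp only [AlgHom.toLinearMap_apply, drinStrandAlg, pairAlg, strandAlg_apply]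
    cases d i <;> simp [hΦ, phi_ofAlg]
  · simp only [AlgHom.toLinearMap_apply, drinStrandDual, pairDual, strandDual_apply]
    cases d j <;> simp [hΦ, phi_ofDual]

/-- Each crossing is transported by `map_strandOp` and then split into its four duplicates. Beyond
the compatibility of `Φ` with `φ`, the target algebra enters only through the commutation of
different components. -/
theorem map_readCrossings (hι : ∀ i j, i ≠ j → ∀ x y, Commute (ι i x) (ι j y))
    (hΦ : ∀ i x, Φ (strandEmb k A i x) = ι i (phi k A x)) (d : Fin n → Dir) (l : List (Crossing n))
    {s : Fin n → Fin n} (hs : s.Injective) (w : ⨂[k] _ : Fin n, DrinfeldDouble k A) :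
    Φ (readCrossings
        (fun b i j w => strandOp (drinStrandAlg d) (drinStrandDual d) b i j w) l s w) =
      readCrossings (fun b x y w => writeCopies ι d b x y w)
        (l.flatMap Crossing.duplicate) (duplicateStrands d s) (Φ w) := by
  simp only [writeCopies_eq]
  induction l generalizing s w with
  | nil => rfl
  | cons c l ih =>
    rw [readCrossings_cons, ih (hs.comp (Equiv.injective _)), List.flatMap_cons,
      readCrossings_duplicate, map_strandOp hΦ]
    congr 1
    rcases c with ⟨p, hp, _ | _⟩
    · exact strandOp_pair_false hι d (hs.ne (Crossing.left_ne_right _)) _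
    · exact strandOp_pair_true hι d (hs.ne (Crossing.left_ne_right _)) _

theorem BraidDiagram.map_J (D : BraidDiagram n) :
    PiTensorProduct.map (fun _ : Fin n => phi k A) (D.J k A) = D.J' k A := by
  let ι (i : Fin n) := PiTensorProduct.singleAlgHom (R := k)
    (A := fun _ : Fin n => HeisenbergDouble k A ⊗[k] (HeisenbergDouble k A)ᵐᵒᵖ) i
  have h := map_readCrossings (ι := ι) (Φ := tensorPower (phiAlgHom k A) n)
    (fun i j h => commute_singleAlgHom (k := k)
      (X := fun _ : Fin n => HeisenbergDouble k A ⊗[k] (HeisenbergDouble k A)ᵐᵒᵖ) h) (tensorPower_singleAlgHom (phiAlgHom k A)) D.dir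
    D.crossings D.top.injective 1
  rw [map_one, ← BraidDiagram.J_eq, ← D.duplicateTop_eq] at h
  refine h.trans ?_
  unfold BraidDiagram.J'
  congr 1

end Main

end

end HopfDouble

theorem mainTheorem2 (k A : Type*) [Field k] [Ring A] [HopfAlgebra k A] [FiniteDimensional k A]
    [HopfDouble.InvertibleAntipode k A] {n : ℕ} (T : HopfDouble.Braid n)
    (D : HopfDouble.BraidDiagram n) (hD : D.IsDiagramOf T) :
    D.J k A = T.J k A ∧
      PiTensorProduct.map (fun _ : Fin n => HopfDouble.phi k A) (T.J k A) = D.J' k A := by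
  refine ⟨HopfDouble.BraidDiagram.J_eq_of_isDiagramOf hD, ?_⟩
  rw [← HopfDouble.BraidDiagram.J_eq_of_isDiagramOf hD]
  exact D.map_J
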